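/- **Graphs.** Fix an alphabet $\mathbb A$ of edge labels $\mathsf r$ with arities. A c-graph of type $n$ is a finite hypergraph $G$ with vertices and edges from fixed countably infinite sets, where every edge has a label and is attached to a sequence of vertices whose length is the arity of the label, together with a sequence of $n$ pairwise distinct vertices, its sources; the other vertices are internal. $G$ is simple if no two edges have the same label and the same attached vertices. **Formulas.** Quantifier- and predicate-free (qpf) formulas are built from $\mathsf{emp}$, $x=y$, $x\neq y$ and relation atoms $\mathsf r(x_1,\dots,x_k)$ by the separating conjunction $*$. For a simple c-graph $G$ of type $0$ and a store $\mathfrak s$ (a map from variables to the vertex universe): $G\models^{\mathfrak s}\mathsf{emp}$ iff $G$ is empty; $G\models^{\mathfrak s}x=y$ (resp. $x\ne y$) iff $G$ is empty and $\mathfrak s(x)=\mathfrak s(y)$ (resp. $\mathfrak s(x)\neq\mathfrak s(y)$); $G\models^{\mathfrak s}\mathsf r(x_1,\dots,x_k)$ iff $G$ consists of a single $\mathsf r$-labelled edge attached to $\mathfrak s(x_1),\dots,\mathfrak s(x_k)$ and of these vertices; $G\models^{\mathfrak s}\phi_1*\phi_2$ iff $G$ is the union of two subgraphs without common edges, with $G_i\models^{\mathfrak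 s}\phi_i$. The store $\mathfrak s$ is canonical for $\phi$ if, for all free variables $x,y$ of $\phi$, $\mathfrak s(x)=\mathfrak s(y)$ only if $x=y$ is a logical consequence of $\phi$. **SIDs.** A SID $\Delta$ is a finite set of rules $\mathsf B_0(x_1,\dots,x_n)\leftarrow\exists y_1\dots\exists y_m.\ \psi*\mathsf B_1(\mathbf z_1)*\dots*\mathsf B_k(\mathbf z_k)$, with $\psi$ a qpf formula, $\mathsf B_0,\dots,\mathsf B_k$ predicates, $n$ the arity of $\mathsf B_0$, and all variables among the $x_i,y_j$. It is equality-free if there are no equalities in $\psi$ and no repeated variables inside a predicate atom $\mathsf B_\ell(\mathbf z_\ell)$. A rule is unproductive if $m=0$, $\psi=\mathsf{emp}$ and $\mathbf z_\ell=(x_1,\dots,x_n)$ for all $\ell$. The SID $\Delta$ is regular if there is a set $\mathbb Q$ of predicates such that each rule is (A) $\mathsf B(\mathbf x)\leftarrow\mathsf B(\mathbf x)*\mathsf C(\mathbf x)$ with $\mathsf B\notin\mathbb Q$, $\mathsf C\in\mathbb Q$; or (B) $\mathsf B(\mathbf x)\leftarrow\mathsf C_1(\mathbf x)*\dots*\mathsf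 C_k(\mathbf x)$ with $k\ge1$, $\mathsf B\notin\mathbb Q$, $\mathsf C_1,\dots,\mathsf C_k\in\mathbb Q$; or (C) a rule with $\mathsf B_0\in\mathbb Q$ such that (1) either $m=k=0$ and $\psi$ has exactly one relation atom, in which all of $x_1,\dots,x_n$ occur, or there is at least one relation or predicate atom and each of them contains some $y_j$; and (2) any two distinct variables of the rule are linked by a path, in which consecutive variables occur together in a relation atom of $\psi$, and whose intermediate variables are all among $y_1,\dots,y_m$. **Grammars.** A hyperedge-replacement (HR) graph grammar $\Gamma=(\mathcal U,\mathcal R)$ has a finite set $\mathcal U$ of nonterminals with arities and a finite set $\mathcal R$ of rules $u\to u_1\parallel_n\dots\parallel_n u_k$ (unproductive; all these nonterminals have arity $n$) or $u\to(G,e_1,\dots,e_k)$, where $G$ is a c-graph with labels in $\mathbb A\cup\mathcal U$ whose type is the arity of $u$, and $e_1,\dots,e_k$ are its $\mathcal U$-labelled edges, each attached to pairwise distinct vertices. The operation $(G,e_1,\dots,e_k)$ replaces each $e_i$ by a graph whose sources are glued to the vertices attached to $e_i$, and $\parallel_n$ takes a disjoint union and glues the $i$-th sources, for all $i$. $\Gamma$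 is regular if there is $W\subseteq\mathcal U$ such that each rule is $u\to u\parallel_n w$ with $u\notin W$, $w\in W$; or $u\to w_1\parallel_n\dots\parallel_n w_k$ with $k\geq1$, $u\notin W$, $w_1,\dots,w_k\in W$; or $w\to(G,e_1,\dots,e_k)$ with $w\in W$ such that (1) either $G$ consists of its sources and of a single edge, labelled in $\mathbb A$ and attached to all of them, or $G$ has an edge and each of its edges is attached to an internal vertex; and (2) any two distinct vertices of $G$ are linked by a path of $\mathbb A$-labelled edges whose intermediate vertices are all internal. **Parse trees.** For $\Delta$ and a predicate $\mathsf A$ (resp. $\Gamma$ and a nonterminal $w$), a derivation tree is a finite tree with edges labelled by rules, an edge labelled by a rule with $k$ predicate atoms (nonterminals) on the right being attached to a parent and to $k$ ordered children that start with these predicates (nonterminals); the root starts with $\mathsf A$ (resp. $w$). A parse tree is a tree obtained, up to isomorphism, from a derivation tree by removing all edges labelled by unproductive rules and merging the vertices attached to each of them. The characteristic formula of a $(\Delta,\mathsf A)$-parse tree $T$, with $\mathsf A$ nullary, is the separating conjunction, over all edges of $T$, of the formulas $\psi$ of their rules, where the $y_j$ are renamed to fresh copies for each edge and the parameters $x_i$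 are replaced by the actual arguments. $\Delta$ is all-satisfiable for $\mathsf A$ if the characteristic formula of each $(\Delta,\mathsf A)$-parse tree is satisfiable. The value of a $\Gamma$-parse tree is the parallel composition, over the edges attached to the root, of the graph operation of their rule applied to the values of the subtrees; the language of $w$ in $\Gamma$ is the set of c-graphs isomorphic to values of $(\Gamma,w)$-parse trees. **Canonical models.** Let $\mathfrak d$ be an additional binary label. A rich canonical $\Delta$-model of a nullary predicate $\mathsf A$ is a c-graph $G$ with labels in $\mathbb A\cup\{\mathfrak d\}$ for which there are a $(\Delta,\mathsf A)$-parse tree $T$ with characteristic formula $\phi$ and a store $\mathfrak s$ canonical for $\phi$, such that the graph $G'$ obtained from $G$ by deleting its $\mathfrak d$-labelled edges satisfies $G'\models^{\mathfrak s}\phi$, and, for all vertices $u,v$, there is a $\mathfrak d$-labelled edge attached to $(u,v)$ iff some $x\neq y$ with $\mathfrak s(x)=u$ and $\mathfrak s(y)=v$ occurs in $\phi$. The graphs $G'$ so obtained are the canonical $\Delta$-models of $\mathsf A$. **Lemma.** Let $\mathsf A$ be a nullary predicate and let $\Delta$ be an equality-free regular SID that is all-satisfiable for $\mathsf A$. Then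 there are a regular HR graph grammar $\Gamma=(\mathcal U,\mathcal R)$, a nonterminal $w\in\mathcal U$ of arity $0$ and a bijection $\gamma:\Delta\to\mathcal R$ such that, for each tree $T$ with edges labelled by rules of $\Delta$, $T$ is a $(\Delta,\mathsf A)$-parse tree iff $\gamma(T)$ is a $(\Gamma,w)$-parse tree, where $\gamma(T)$ is obtained from $T$ by changing every edge label $\rho$ into $\gamma(\rho)$. Moreover, the set of canonical $\Delta$-models of $\mathsf A$ equals the language of $w$ in $\Gamma$. -/

import Mathlib

universe u v

/-! ## Concrete graphs -/

/-- A labelled hyperedge: its identity, its label and its sequence of attached vertices. -/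
structure HEdge (Λ : Type u) where
  id : ℕ
  lab : Λ
  att : List ℕ

/-- Finite concrete hypergraphs (c-graphs) with edge labels in the ranked alphabet `(Λ, ar)`.
Vertices and edge identities are drawn from countably infinite sets. The edge set together with the
label and attachment maps is given by the finite set of triples `(id, label, attached vertices)`, in
which every identity occurs once. The list `src` enumerates the (pairwise distinct) sources, and its
length is the type of the graph. -/
structure CGraph {Λ : Type u} (ar : Λ → ℕ) where
  verts : Set ℕ
  edges : Set (HEdge Λ)
  src : List ℕ
  verts_finite : verts.Finite
  edges_finite : edges.Finite
  id_inj : ∀ e ∈ edges, ∀ e' ∈ edges, e.id = e'.id → e = e'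
  att_length : ∀ e ∈ edges, e.att.length = ar e.lab
  att_mem : ∀ e ∈ edges, ∀ x ∈ e.att, x ∈ verts
  src_mem : ∀ x ∈ src, x ∈ verts
  src_nodup : src.Nodup

namespace CGraph

variable {Λ : Type u} {ar : Λ → ℕ}

/-- The identities of the edges. -/
def ids (G : CGraph ar) : Set ℕ := HEdge.id '' G.edges

/-- No two distinct edges have the same label and the same attached vertices. -/
def Simple (G : CGraph ar) : Prop :=
  ∀ e ∈ G.edges, ∀ e' ∈ G.edges, e.lab = e'.lab → e.att = e'.att → e = e'

/-- Isomorphism of c-graphs: `f` renames the vertices and `g` the edges. -/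
def Iso (G H : CGraph ar) : Prop :=
  ∃ f g : ℕ → ℕ, Set.InjOn f G.verts ∧ Set.InjOn g G.ids ∧
    H.verts = f '' G.verts ∧
    H.edges = (fun e : HEdge Λ => ⟨g e.id, e.lab, e.att.map f⟩) '' G.edges ∧
    H.src = G.src.map f

/-- `K` is a parallel composition of `G` and `H`: the union of isomorphic copies of `G` and `H` that
have the same sources, share no other vertices, and share no edges. -/
def IsPar (G H K : CGraph ar) : Prop :=
  ∃ G' H' : CGraph ar, G.Iso G' ∧ H.Iso H' ∧
    G'.src = H'.src ∧
    G'.verts ∩ H'.verts = {x | x ∈ G'.src} ∧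
    Disjoint G'.ids H'.ids ∧
    K.verts = G'.verts ∪ H'.verts ∧
    K.edges = G'.edges ∪ H'.edges ∧
    K.src = G'.src

/-- The graph consists only of its sources. -/
def IsDiscrete (G : CGraph ar) : Prop :=
  G.verts = {x | x ∈ G.src} ∧ G.edges = ∅

end CGraph

/-! ## Quantifier- and predicate-free formulas -/

/-- Equalities, disequalities and relation atoms over the variables `V`. -/
inductive Atom {L : Type u} (ar : L → ℕ) (V : Type v) : Type (max u v)
  | eq (x y : V)
  | neq (x y : V)
  | rel (r : L) (xs : Fin (ar r) → V)

/-- Quantifier- and predicate-free (qpf) formulas: `emp`, atoms, separating conjunction. -/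
inductive QFormula {L : Type u} (ar : L → ℕ) (V : Type v) : Type (max u v)
  | emp
  | atom (a : Atom ar V)
  | star (φ ψ : QFormula ar V)

namespace Atom

variable {L : Type u} {ar : L → ℕ} {V W : Type*}

def subst (σ : V → W) : Atom ar V → Atom ar W
  | eq x y => eq (σ x) (σ y)
  | neq x y => neq (σ x) (σ y)
  | rel r xs => rel r (fun i => σ (xs i))

def vars : Atom ar V → Set V
  | eq x y => {x, y}
  | neq x y => {x, y}
  | rel _ xs => Set.range xs

def isRel : Atom ar V → Bool
  | eq _ _ => false
  | neq _ _ => false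
  | rel _ _ => true

/-- Satisfaction of an atom by a type-`0` graph, under a store `s`. -/
def Sat (G : CGraph ar) (s : V → ℕ) : Atom ar V → Prop
  | eq x y => G.verts = ∅ ∧ G.edges = ∅ ∧ s x = s y
  | neq x y => G.verts = ∅ ∧ G.edges = ∅ ∧ s x ≠ s y
  | rel r xs => G.verts = Set.range (fun i => s (xs i)) ∧
      ∃ k : ℕ, G.edges = {⟨k, r, List.ofFn (fun i => s (xs i))⟩}

end Atom

namespace QFormula

variable {L : Type u} {ar : L → ℕ} {V W : Type*}

/-- The occurrences of atoms in a formula. -/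
def atoms : QFormula ar V → List (Atom ar V)
  | emp => []
  | atom a => [a]
  | star φ ψ => φ.atoms ++ ψ.atoms

def subst (σ : V → W) : QFormula ar V → QFormula ar W
  | emp => emp
  | atom a => atom (a.subst σ)
  | star φ ψ => star (φ.subst σ) (ψ.subst σ)

/-- Free variables. -/
def fv (φ : QFormula ar V) : Set V := {x | ∃ a ∈ φ.atoms, x ∈ a.vars}

/-- Iterated separating conjunction. -/
def bigStar (l : List (QFormula ar V)) : QFormula ar V := l.foldr star emp

/-- Satisfaction. A separating conjunction splits the graph into two subgraphs
with no common edge. -/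
def Sat (s : V → ℕ) : QFormula ar V → CGraph ar → Prop
  | emp, G => G.verts = ∅ ∧ G.edges = ∅
  | atom a, G => a.Sat G s
  | star φ ψ, G => ∃ G₁ G₂ : CGraph ar, G₁.src = [] ∧ G₂.src = [] ∧
      Disjoint G₁.ids G₂.ids ∧
      G.verts = G₁.verts ∪ G₂.verts ∧ G.edges = G₁.edges ∪ G₂.edges ∧
      φ.Sat s G₁ ∧ ψ.Sat s G₂

/-- `G ⊨ˢ φ`: models are simple c-graphs of type `0`. -/
def Models (G : CGraph ar) (s : V → ℕ) (φ : QFormula ar V) : Prop :=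
  G.src = [] ∧ G.Simple ∧ φ.Sat s G

def Satisfiable (φ : QFormula ar V) : Prop :=
  ∃ (G : CGraph ar) (s : V → ℕ), Models G s φ

/-- The equality `x = y` is a logical consequence of `φ`. -/
def EntailsEq (φ : QFormula ar V) (x y : V) : Prop :=
  ∀ (G : CGraph ar) (s : V → ℕ), Models G s φ → s x = s y

/-- The store `s` is canonical for `φ`. -/
def Canonical (s : V → ℕ) (φ : QFormula ar V) : Prop :=
  ∀ x ∈ φ.fv, ∀ y ∈ φ.fv, s x = s y → φ.EntailsEq x y

end QFormula

/-! ## Derivation trees and parse trees -/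

/-- Ordered trees labelled by rules. -/
inductive DTree (R : Type u) : Type u
  | node (ρ : R) (k : ℕ) (sub : Fin k → DTree R)

/-- Finite rooted trees whose (hyper)edges are labelled by `R`. `leaf` is a single vertex;
`edge ρ k sub rest` is obtained from `rest` by attaching to its root one more edge, labelled by `ρ`,
whose first attached vertex is that root and whose remaining `k` attached vertices are the roots of
the trees `sub 0, …, sub (k - 1)`. -/
inductive PTree (R : Type u) : Type u
  | leaf
  | edge (ρ : R) (k : ℕ) (sub : Fin k → PTree R) (rest : PTree R)

namespace PTree

variable {R S : Type*}

/-- Relabelling of the edges. -/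
def map (f : R → S) : PTree R → PTree S
  | leaf => leaf
  | edge ρ k sub rest => edge (f ρ) k (fun i => (sub i).map f) (rest.map f)

/-- Joining two trees at their roots. -/
def join : PTree R → PTree R → PTree R
  | leaf, t => t
  | edge ρ k sub rest, t => edge ρ k sub (rest.join t)

/-- Isomorphism of trees: the edges below a vertex are not ordered. -/
inductive Iso : PTree R → PTree R → Prop
  | leaf : Iso leaf leaf
  | edge (ρ : R) (k : ℕ) (sub sub' : Fin k → PTree R) (rest rest' : PTree R) :
      (∀ i, Iso (sub i) (sub' i)) → Iso rest rest' →
      Iso (edge ρ k sub rest) (edge ρ k sub' rest')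
  | swap (ρ : R) (k : ℕ) (sub : Fin k → PTree R) (ρ' : R) (k' : ℕ) (sub' : Fin k' → PTree R)
      (rest : PTree R) :
      Iso (edge ρ k sub (edge ρ' k' sub' rest)) (edge ρ' k' sub' (edge ρ k sub rest))
  | trans (t₁ t₂ t₃ : PTree R) : Iso t₁ t₂ → Iso t₂ t₃ → Iso t₁ t₃

end PTree

namespace DTree

variable {R N : Type*}

/-- `U.Derives lhs rhs a`: the tree `U` is a derivation tree starting with the nonterminal `a`, where
`lhs ρ` is the left-hand side of the rule `ρ` and `rhs ρ` the sequence of nonterminals of its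
right-hand side. -/
def Derives (lhs : R → N) (rhs : R → List N) : DTree R → N → Prop
  | node ρ k sub, a => lhs ρ = a ∧
      ∃ h : (rhs ρ).length = k, ∀ i : Fin k,
        (sub i).Derives lhs rhs ((rhs ρ).get (i.cast h.symm))

open Classical in
/-- Removal of all edges labelled by unproductive rules: the vertices attached to such an edge are
merged. -/
noncomputable def contract (unprod : R → Prop) : DTree R → PTree R
  | node ρ k sub =>
      if unprod ρ then
        (List.ofFn (fun i => (sub i).contract unprod)).foldr PTree.join PTree.leaf
      else
        PTree.edge ρ k (fun i => (sub i).contract unprod) PTree.leaf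

end DTree

/-- The parse trees of a system of rules: the trees obtained from derivation trees by removing the
edges labelled by unproductive rules, up to isomorphism. -/
def parseTrees {R N : Type*} (lhs : R → N) (rhs : R → List N) (unprod : R → Prop) (a : N) :
    Set (PTree R) :=
  {T | ∃ U : DTree R, U.Derives lhs rhs a ∧ (U.contract unprod).Iso T}

/-- `a` and `b` are linked by a path of `adj`-steps whose intermediate points are all internal. -/
inductive InternalPath {V : Type*} (adj : V → V → Prop) (internal : V → Prop) : V → V → Prop
  | single (a b : V) : adj a b → InternalPath adj internal a b
  | cons (a c b : V) : adj a c → internal c → InternalPath adj internal c b →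
      InternalPath adj internal a b

/-! ## Sets of inductive definitions -/

/-- A predicate atom `B(z₁, …, z_{#B})`. -/
structure PredAtom {P : Type u} (arP : P → ℕ) (V : Type v) where
  pred : P
  args : Fin (arP pred) → V

/-- A rule `B₀(x₁, …, xₙ) ← ∃ y₁ … ∃ yₘ . ψ * B₁(z₁) * … * Bₖ(zₖ)`, with `n = #B₀`. The variable
`xᵢ` is `Sum.inl i` and `yⱼ` is `Sum.inr j`. -/
structure SIDRule {L : Type u} (ar : L → ℕ) {P : Type v} (arP : P → ℕ) where
  head : P
  m : ℕ
  psi : QFormula ar (Fin (arP head) ⊕ Fin m)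
  calls : List (PredAtom arP (Fin (arP head) ⊕ Fin m))

namespace SIDRule

variable {L : Type u} {ar : L → ℕ} {P : Type v} {arP : P → ℕ}

/-- The predicate atom is `B(x₁, …, xₙ)`, where `x₁, …, xₙ` are exactly the parameters of the rule. -/
def PassesParams (ρ : SIDRule ar arP) (c : PredAtom arP (Fin (arP ρ.head) ⊕ Fin ρ.m)) : Prop :=
  List.ofFn c.args = List.ofFn (fun i : Fin (arP ρ.head) => Sum.inl i)

/-- The rule is `B₀(x₁, …, xₙ) ← B₁(x₁, …, xₙ) * … * Bₖ(x₁, …, xₙ)`. -/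
def Unproductive (ρ : SIDRule ar arP) : Prop :=
  ρ.m = 0 ∧ ρ.psi = QFormula.emp ∧ ∀ c ∈ ρ.calls, ρ.PassesParams c

/-- Two variables occur in the same relation atom. -/
def Adj (ρ : SIDRule ar arP) (z z' : Fin (arP ρ.head) ⊕ Fin ρ.m) : Prop :=
  ∃ a ∈ ρ.psi.atoms, a.isRel = true ∧ z ∈ a.vars ∧ z' ∈ a.vars

/-- The condition on the body of a productive rule of a regular SID. -/
def RegularBody (ρ : SIDRule ar arP) : Prop :=
  ((ρ.m = 0 ∧ ρ.calls = [] ∧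
      ∃ a, ρ.psi.atoms.filter Atom.isRel = [a] ∧ ∀ z, z ∈ a.vars) ∨
    (((∃ a ∈ ρ.psi.atoms, a.isRel = true) ∨ ρ.calls ≠ []) ∧
      (∀ a ∈ ρ.psi.atoms, a.isRel = true → ∃ j, Sum.inr j ∈ a.vars) ∧
      (∀ c ∈ ρ.calls, ∃ j, Sum.inr j ∈ Set.range c.args))) ∧
  ∀ z z', z ≠ z' → InternalPath ρ.Adj (fun t => t.isRight = true) z z'

/-- No equalities, and no predicate atom with two occurrences of a variable. -/
def EqualityFree (ρ : SIDRule ar arP) : Prop :=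
  (∀ x y, Atom.eq x y ∉ ρ.psi.atoms) ∧ ∀ c ∈ ρ.calls, Function.Injective c.args

end SIDRule

/-- A set of inductive definitions: a finite set of rules. -/
structure SID {L : Type u} (ar : L → ℕ) {P : Type v} (arP : P → ℕ) where
  rules : Set (SIDRule ar arP)
  finite : rules.Finite

/-- The variables of characteristic formulas: `(p, j)` is the copy of the existentially quantified
variable `yⱼ` introduced by the edge with address `p` of a parse tree. -/
abbrev TVar : Type := List ℕ × ℕ

/-- The alphabet extended by the binary label `none`, recording disequalities. -/
def arD {L : Type u} (ar : L → ℕ) : Option L → ℕ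
  | none => 2
  | some r => ar r

/-- Deletion of the edges with the label `none`. -/
def CGraph.proj {L : Type u} {ar : L → ℕ} (G : CGraph (arD ar)) : CGraph ar where
  verts := G.verts
  edges := {e | (⟨e.id, some e.lab, e.att⟩ : HEdge (Option L)) ∈ G.edges}
  src := G.src
  verts_finite := G.verts_finite
  edges_finite := by
    refine G.edges_finite.preimage
      (f := fun e : HEdge L => (⟨e.id, some e.lab, e.att⟩ : HEdge (Option L))) ?_
    rintro ⟨i, r, a⟩ - ⟨j, q, b⟩ - h
    simpa using h
  id_inj := by
    rintro ⟨i, r, a⟩ he ⟨j, q, b⟩ he' h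
    simpa using G.id_inj _ he _ he' h
  att_length := fun e he => G.att_length _ he
  att_mem := fun e he => G.att_mem _ he
  src_mem := G.src_mem
  src_nodup := G.src_nodup

namespace SID

variable {L : Type u} {ar : L → ℕ} {P : Type v} {arP : P → ℕ}

def EqualityFree (Δ : SID ar arP) : Prop := ∀ ρ ∈ Δ.rules, ρ.EqualityFree

/-- Regular SIDs; `Q` is the set of productive predicates. The rules are
`B(x) ← B(x) * C(x)` with `B ∉ Q` and `C ∈ Q`, or
`B(x) ← C₁(x) * … * Cₖ(x)` with `k ≥ 1`, `B ∉ Q` and `C₁, …, Cₖ ∈ Q`, or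
rules with a head in `Q` and a regular body. -/
def Regular (Δ : SID ar arP) : Prop :=
  ∃ Q : Set P, ∀ ρ ∈ Δ.rules,
    (ρ.head ∉ Q ∧ ρ.Unproductive ∧
      ∃ C ∈ Q, ρ.calls.map PredAtom.pred = [ρ.head, C]) ∨
    (ρ.head ∉ Q ∧ ρ.Unproductive ∧ ρ.calls ≠ [] ∧ ∀ c ∈ ρ.calls, c.pred ∈ Q) ∨
    (ρ.head ∈ Q ∧ ρ.RegularBody)

/-- The `(Δ, A)`-parse trees. -/
def parseTrees (Δ : SID ar arP) (A : P) : Set (PTree Δ.rules) :=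
  _root_.parseTrees (fun ρ : Δ.rules => ρ.1.head)
    (fun ρ : Δ.rules => ρ.1.calls.map PredAtom.pred) (fun ρ : Δ.rules => ρ.1.Unproductive) A

/-- The instantiation of the variables of a rule labelling the edge with address `p` below a vertex
with actual parameters `args`. -/
def inst {n m : ℕ} (args : List TVar) (p : List ℕ) : Fin n ⊕ Fin m → TVar
  | Sum.inl i => args.getD i ([], 0)
  | Sum.inr j => (p, j)

/-- The characteristic formula of a tree whose root has the actual parameters `args`. The list `p`
serves as an address that makes the copies of the existentially quantified variables fresh: distinct
edges have distinct addresses. -/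
def charFormAux {Δ : SID ar arP} : PTree Δ.rules → List TVar → List ℕ → QFormula ar TVar
  | PTree.leaf, _, _ => QFormula.emp
  | PTree.edge ρ k sub rest, args, p =>
      QFormula.star (ρ.1.psi.subst (inst args p))
        (QFormula.star
          (QFormula.bigStar (List.ofFn (fun i : Fin k =>
            charFormAux (sub i)
              (((ρ.1.calls[(i : ℕ)]?).map
                (fun c => List.ofFn (fun j => inst args p (c.args j)))).getD [])
              (((i : ℕ) + 1) :: p))))
          (charFormAux rest args (0 :: p)))

/-- The characteristic formula of a parse tree of a nullary predicate. -/
def charForm {Δ : SID ar arP} (T : PTree Δ.rules) : QFormula ar TVar := charFormAux T [] []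

def AllSatisfiable (Δ : SID ar arP) (A : P) : Prop :=
  ∀ T ∈ Δ.parseTrees A, (charForm T).Satisfiable

/-- Rich canonical `Δ`-models of a nullary predicate `A`. -/
def richCanonicalModels (Δ : SID ar arP) (A : P) : Set (CGraph (arD ar)) :=
  {G | ∃ T ∈ Δ.parseTrees A, ∃ s : TVar → ℕ,
    QFormula.Canonical s (charForm T) ∧
    QFormula.Models G.proj s (charForm T) ∧
    ∀ a ∈ G.verts, ∀ b ∈ G.verts,
      ((∃ e ∈ G.edges, e.lab = none ∧ e.att = [a, b]) ↔
        ∃ x y, s x = a ∧ s y = b ∧ Atom.neq x y ∈ (charForm T).atoms)}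

/-- Canonical `Δ`-models of a nullary predicate `A`. -/
def canonicalModels (Δ : SID ar arP) (A : P) : Set (CGraph ar) :=
  CGraph.proj '' Δ.richCanonicalModels A

end SID

/-! ## Hyperedge-replacement graph grammars -/

/-- Right-hand sides of grammar rules: `u₁ ∥ … ∥ uₖ`, or `(G, e₁, …, eₖ)` where `G` is a
c-graph with edges labelled by terminals (`Sum.inl`) or nonterminals (`Sum.inr`), and `e₁, …, eₖ` are
its nonterminal-labelled edges. -/
inductive HRRhs {L : Type u} (ar : L → ℕ) {N : Type v} (arN : N → ℕ) : Type (max u v)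
  | par (us : List N)
  | op (G : CGraph (Sum.elim ar arN)) (es : List (HEdge N))

namespace HRRhs

variable {L : Type u} {ar : L → ℕ} {N : Type v} {arN : N → ℕ}

/-- The sequence of nonterminals of a right-hand side. -/
def nonterms : HRRhs ar arN → List N
  | par us => us
  | op _ es => es.map HEdge.lab

def IsPar : HRRhs ar arN → Prop
  | par _ => True
  | op _ _ => False

/-- Well-formedness of a right-hand side of type `n`: all components of a parallel composition
have type `n`; in `(G, e₁, …, eₖ)`, the graph `G` has type `n` and `e₁, …, eₖ` enumerates
its nonterminal-labelled edges without repetition, each attached to pairwise distinct vertices. -/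
def WellFormed (n : ℕ) : HRRhs ar arN → Prop
  | par us => ∀ a ∈ us, arN a = n
  | op G es => G.src.length = n ∧ es.Nodup ∧ (∀ e ∈ es, e.att.Nodup) ∧
      ∀ e : HEdge N, e ∈ es ↔ (⟨e.id, Sum.inr e.lab, e.att⟩ : HEdge (L ⊕ N)) ∈ G.edges

/-- The terminal-labelled edges of a graph. -/
def termEdges (G : CGraph (Sum.elim ar arN)) : Set (HEdge L) :=
  {e | (⟨e.id, Sum.inl e.lab, e.att⟩ : HEdge (L ⊕ N)) ∈ G.edges}

/-- Regularity of a graph operation `(G, e₁, …, eₖ)`. Either `G` consists of its sources and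
of a single edge, which is terminal and attached to all of them, or `G` has an edge and
each of its edges is attached to some internal (non-source) vertex; moreover, any two vertices are
linked by a path of terminal edges that traverses only internal vertices, except for its ends. -/
def RegularOp (G : CGraph (Sum.elim ar arN)) : Prop :=
  ((∃ e : HEdge L, G.edges = {⟨e.id, Sum.inl e.lab, e.att⟩} ∧
      G.verts = {x | x ∈ G.src} ∧ ∀ x ∈ G.src, x ∈ e.att) ∨
    (G.edges.Nonempty ∧ ∀ e ∈ G.edges, ∃ x ∈ e.att, x ∉ G.src)) ∧
  ∀ x ∈ G.verts, ∀ y ∈ G.verts, x ≠ y →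
    InternalPath (fun a b => ∃ e ∈ termEdges G, a ∈ e.att ∧ b ∈ e.att) (fun a => a ∉ G.src) x y

/-- `K` is obtained from `G` by replacing each edge `es i` by an isomorphic copy of `H i`, whose
sequence of sources is the sequence of vertices attached to that edge; the copies are otherwise
disjoint from `G` and from each other. -/
def IsSubst (G : CGraph (Sum.elim ar arN)) (es : List (HEdge N)) {k : ℕ}
    (H : Fin k → CGraph ar) (K : CGraph ar) : Prop :=
  ∃ (h : es.length = k) (H' : Fin k → CGraph ar),
    (∀ i, (H i).Iso (H' i)) ∧
    (∀ i, (H' i).src = (es.get (i.cast h.symm)).att) ∧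
    (∀ i, (H' i).verts ∩ G.verts = {x | x ∈ (H' i).src}) ∧
    (∀ i j, i ≠ j → (H' i).verts ∩ (H' j).verts ⊆ G.verts) ∧
    (∀ i, Disjoint (H' i).ids (HEdge.id '' termEdges G)) ∧
    (∀ i j, i ≠ j → Disjoint (H' i).ids (H' j).ids) ∧
    K.verts = G.verts ∪ ⋃ i, (H' i).verts ∧
    K.edges = termEdges G ∪ ⋃ i, (H' i).edges ∧
    K.src = G.src

end HRRhs

/-- A hyperedge-replacement graph grammar: a finite set of nonterminals and a finite set of rules
`u → rhs`. -/
structure HRGrammar {L : Type u} (ar : L → ℕ) {N : Type v} (arN : N → ℕ) where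
  nonterms : Set N
  rules : Set (N × HRRhs ar arN)
  nonterms_finite : nonterms.Finite
  rules_finite : rules.Finite
  lhs_mem : ∀ ρ ∈ rules, ρ.1 ∈ nonterms
  rhs_mem : ∀ ρ ∈ rules, ∀ a ∈ ρ.2.nonterms, a ∈ nonterms
  wellFormed : ∀ ρ ∈ rules, ρ.2.WellFormed (arN ρ.1)

namespace HRGrammar

variable {L : Type u} {ar : L → ℕ} {N : Type v} {arN : N → ℕ}

/-- Regular graph grammars. The rules are `u → u ∥ w` with `u ∉ W` and `w ∈ W`, or
`u → w₁ ∥ … ∥ wₖ` with `k ≥ 1`, `u ∉ W` and `w₁, …, wₖ ∈ W`, or `w → (G, e₁, …, eₖ)`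
with `w ∈ W` and a regular graph operation. -/
def Regular (Γ : HRGrammar ar arN) : Prop :=
  ∃ W ⊆ Γ.nonterms, ∀ ρ ∈ Γ.rules,
    (ρ.1 ∉ W ∧ ∃ w ∈ W, ρ.2 = HRRhs.par [ρ.1, w]) ∨
    (ρ.1 ∉ W ∧ ∃ ws, ws ≠ [] ∧ (∀ w ∈ ws, w ∈ W) ∧ ρ.2 = HRRhs.par ws) ∨
    (ρ.1 ∈ W ∧ ∃ G es, ρ.2 = HRRhs.op G es ∧ HRRhs.RegularOp G)

/-- The `(Γ, w)`-parse trees. -/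
def parseTrees (Γ : HRGrammar ar arN) (w : N) : Set (PTree Γ.rules) :=
  _root_.parseTrees (fun ρ : Γ.rules => ρ.1.1)
    (fun ρ : Γ.rules => ρ.1.2.nonterms) (fun ρ : Γ.rules => ρ.1.2.IsPar) w

/-- `K` is (a c-graph in the isomorphism class of) the value of a parse tree: the parallel
composition, over the edges attached to the root, of the graph operation labelling the edge applied to
the values of the subtrees. -/
def IsVal {Γ : HRGrammar ar arN} : PTree Γ.rules → CGraph ar → Prop
  | PTree.leaf, K => K.IsDiscrete
  | PTree.edge ρ k sub rest, K =>
      ∃ (G : CGraph (Sum.elim ar arN)) (es : List (HEdge N)) (H : Fin k → CGraph ar)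
        (K₁ K₂ : CGraph ar),
        ρ.1.2 = HRRhs.op G es ∧ (∀ i, IsVal (sub i) (H i)) ∧ HRRhs.IsSubst G es H K₁ ∧
        IsVal rest K₂ ∧ CGraph.IsPar K₁ K₂ K

/-- The language of `w` in `Γ`. -/
def language (Γ : HRGrammar ar arN) (w : N) : Set (CGraph ar) :=
  {K | K.src.length = arN w ∧ ∃ T ∈ Γ.parseTrees w, IsVal T K}

end HRGrammar

/-!
A parse tree determines an abstract hypergraph, whose vertices are the variables of its
characteristic formula and whose edges are the occurrences of relation atoms in it. The grammar rule
of a rule of `Δ` has the variables of the rule as its vertices and the atoms as its edges, so the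
values of `γ(T)` are exactly the copies of the hypergraph of `T`.

The canonical models are exactly the copies as well. Regularity makes every variable occur in some
relation atom, so that a model has no other vertices than the values of the variables. Without
equalities, a satisfiable formula is satisfied under every injective store, so the canonical stores
are exactly the injective ones, and satisfiability forces the copies to be simple.
-/

/-! ## Gluing injective maps -/

section Gluing

variable {X Y ι : Type*}

theorem exists_injOn_glue [Nonempty Y] (V : ι → Set X) (f : ι → X → Y)
    (h : ∀ i j, ∀ x ∈ V i, ∀ y ∈ V j, (f i x = f j y ↔ x = y)) :
    ∃ F : X → Y, (∀ i, Set.EqOn F (f i) (V i)) ∧ Set.InjOn F (⋃ i, V i) := by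
  classical
  let F : X → Y := fun x => if hx : ∃ i, x ∈ V i then f hx.choose x else Classical.arbitrary Y
  have hF : ∀ i, Set.EqOn F (f i) (V i) := by
    intro i x hx
    have hx' : ∃ i, x ∈ V i := ⟨i, hx⟩
    simp only [F, dif_pos hx']
    exact (h _ _ _ hx'.choose_spec _ hx).2 rfl
  refine ⟨F, hF, ?_⟩
  intro x hx y hy hxy
  obtain ⟨i, hi⟩ := Set.mem_iUnion.1 hx
  obtain ⟨j, hj⟩ := Set.mem_iUnion.1 hy
  rw [hF i hi, hF j hj] at hxy
  exact (h _ _ _ hi _ hj).1 hxy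

theorem eq_iff_eq_of_injOn_of_eqOn_inter {f g : X → Y} {V W : Set X} (hf : Set.InjOn f V)
    (hg : Set.InjOn g W) (hfg : Set.EqOn f g (V ∩ W)) (himage : f '' V ∩ g '' W ⊆ f '' (V ∩ W))
    {x y : X} (hx : x ∈ V) (hy : y ∈ W) : f x = g y ↔ x = y := by
  constructor
  · intro hxy
    obtain ⟨z, hz, hzx⟩ := himage ⟨⟨x, hx, rfl⟩, y, hy, hxy.symm⟩
    obtain rfl : z = x := hf hz.1 hx hzx
    exact hg hz.2 hy ((hfg hz).symm.trans hxy)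
  · rintro rfl
    exact hfg ⟨hx, hy⟩

/-- The shape needed for graphs `G₁, G₂, …` glued to a graph `G₀`: the sets `V i` and their images
may overlap only within `V₀` and its image. -/
theorem exists_injOn_amalgam [Nonempty Y] {V₀ : Set X} {V : ι → Set X} {f₀ : X → Y}
    {f : ι → X → Y} (h₀ : Set.InjOn f₀ V₀) (h : ∀ i, Set.InjOn (f i) (V i))
    (eqOn : ∀ i, Set.EqOn f₀ (f i) (V₀ ∩ V i))
    (inter_subset : ∀ i j, i ≠ j → V i ∩ V j ⊆ V₀)
    (image_inter_subset₀ : ∀ i, f₀ '' V₀ ∩ f i '' V i ⊆ f₀ '' (V₀ ∩ V i))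
    (image_inter_subset : ∀ i j, i ≠ j → f i '' V i ∩ f j '' V j ⊆ f₀ '' V₀) :
    ∃ F : X → Y, Set.EqOn F f₀ V₀ ∧ (∀ i, Set.EqOn F (f i) (V i)) ∧
      Set.InjOn F (V₀ ∪ ⋃ i, V i) := by
  have base_iff : ∀ i, ∀ x ∈ V₀, ∀ y ∈ V i, (f₀ x = f i y ↔ x = y) := fun i x hx y hy =>
    eq_iff_eq_of_injOn_of_eqOn_inter h₀ (h i) (eqOn i) (image_inter_subset₀ i) hx hy
  have part_iff : ∀ i j, ∀ x ∈ V i, ∀ y ∈ V j, (f i x = f j y ↔ x = y) := by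
    intro i j x hx y hy
    by_cases hij : i = j
    · subst hij
      exact (h i).eq_iff hx hy
    constructor
    · intro hxy
      obtain ⟨z, hz, hzx⟩ := image_inter_subset i j hij ⟨⟨x, hx, rfl⟩, y, hy, hxy.symm⟩
      rw [← (base_iff i z hz x hx).1 hzx, ← (base_iff j z hz y hy).1 (hzx.trans hxy)]
    · rintro rfl
      have hx₀ := inter_subset i j hij ⟨hx, hy⟩
      exact (eqOn i ⟨hx₀, hx⟩).symm.trans (eqOn j ⟨hx₀, hy⟩)
  obtain ⟨F, hF, hinj⟩ := exists_injOn_glue (fun o : Option ι => o.elim V₀ V)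
    (fun o => o.elim f₀ f) (by
      rintro (_ | i) (_ | j) x hx y hy
      · exact h₀.eq_iff hx hy
      · exact base_iff j x hx y hy
      · rw [eq_comm, @eq_comm _ x]
        exact base_iff i y hy x hx
      · exact part_iff i j x hx y hy)
  rw [Set.iUnion_option] at hinj
  exact ⟨F, hF none, fun i => hF (some i), hinj⟩

theorem exists_injOn_union_of_disjoint {f g : X → Y} {V W : Set X} (hf : Set.InjOn f V)
    (hg : Set.InjOn g W) (hVW : Disjoint V W) (hfg : Disjoint (f '' V) (g '' W)) :
    ∃ F : X → Y, Set.EqOn F f V ∧ Set.EqOn F g W ∧ Set.InjOn F (V ∪ W) := by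
  classical
  have hF₁ : Set.EqOn (V.piecewise f g) f V := Set.piecewise_eqOn V f g
  have hF₂ : Set.EqOn (V.piecewise f g) g W :=
    (Set.piecewise_eqOn_compl V f g).mono hVW.subset_compl_left
  refine ⟨V.piecewise f g, hF₁, hF₂,
    (Set.injOn_union hVW).2 ⟨hf.congr hF₁.symm, hg.congr hF₂.symm, fun x hx y hy => ?_⟩⟩
  rw [hF₁ hx, hF₂ hy]
  exact hfg.ne_of_mem ⟨x, hx, rfl⟩ ⟨y, hy, rfl⟩

theorem exists_injective_eqOn [Encodable X] {V : Set X} {f : X → ℕ} (hV : V.Finite)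
    (hf : Set.InjOn f V) : ∃ F : X → ℕ, Set.EqOn F f V ∧ Function.Injective F := by
  obtain ⟨M, hM⟩ := (hV.image f).bddAbove
  have hcode : Function.Injective fun x : X => M + 1 + Encodable.encode x := fun x y hxy =>
    Encodable.encode_injective (Nat.add_left_cancel hxy)
  have hdisj : Disjoint (f '' V) ((fun x : X => M + 1 + Encodable.encode x) '' Vᶜ) := by
    refine Set.disjoint_left.2 ?_
    rintro _ hy ⟨x, -, rfl⟩
    have hle : M + 1 + Encodable.encode x ≤ M := hM hy
    omega
  obtain ⟨F, hF, -, hinj⟩ :=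
    exists_injOn_union_of_disjoint hf hcode.injOn disjoint_compl_right hdisj
  rw [Set.union_compl_self, Set.injOn_univ] at hinj
  exact ⟨F, hF, hinj⟩

theorem exists_eqOn_comp_of_injOn [Nonempty Y] {Z : Type*} {f : X → Z} {V : Set X}
    (hf : Set.InjOn f V) (g : X → Y) : ∃ k : Z → Y, Set.EqOn (k ∘ f) g V :=
  ⟨Function.extend (V.domRestrict f) (V.domRestrict g) fun _ => Classical.arbitrary Y, fun x hx =>
    hf.injective.extend_apply (V.domRestrict g) (fun _ => Classical.arbitrary Y) ⟨x, hx⟩⟩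

theorem disjoint_image_image_of_injOn {f : X → Y} {U V W : Set X} (hf : Set.InjOn f U)
    (hV : V ⊆ U) (hW : W ⊆ U) (hVW : Disjoint V W) : Disjoint (f '' V) (f '' W) := by
  rw [Set.disjoint_iff_inter_eq_empty, ← hf.image_inter hV hW, hVW.inter_eq, Set.image_empty]

end Gluing

/-! ## Abstract hypergraphs and their copies -/

attribute [ext] CGraph

/-- A hyperedge whose identity (its address) and attached vertices are drawn from an arbitrary type
`X`, such as the variables of a formula. -/
structure PreEdge (L : Type u) (X : Type v) where
  addr : X
  lab : L
  att : List X

namespace PreEdge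

variable {L : Type u} {X : Type v}

/-- The concrete edge obtained by renaming the attached vertices with `s` and the address with
`g`. -/
def real (s g : X → ℕ) (e : PreEdge L X) : HEdge L :=
  ⟨g e.addr, e.lab, e.att.map s⟩

theorem real_congr {s g s' g' : X → ℕ} {e : PreEdge L X} (hs : ∀ x ∈ e.att, s x = s' x)
    (hg : g e.addr = g' e.addr) : real s g e = real s' g' e := by
  simp only [real, hg, List.map_congr_left hs]

theorem real_comp (s g : X → ℕ) (f k : ℕ → ℕ) : (real (f ∘ s) (k ∘ g) : PreEdge L X → HEdge L) =
    (fun e : HEdge L => ⟨k e.id, e.lab, e.att.map f⟩) ∘ real s g :=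
  funext fun e => by simp only [real, Function.comp, List.map_map]

theorem image_id_image_real (s g : X → ℕ) (E : Set (PreEdge L X)) :
    HEdge.id '' (real s g '' E) = g '' (addr '' E) := by
  simp only [Set.image_image, real]

end PreEdge

/-- A hypergraph with sources whose vertices and edge identities are drawn from `X`. It stands
for the isomorphism class of the c-graphs obtained by naming them injectively. -/
structure PreGraph (L : Type u) (X : Type v) where
  verts : Set X
  edges : Set (PreEdge L X)
  src : List X

namespace PreGraph

variable {L : Type u} {ar : L → ℕ} {X : Type v} {D : PreGraph L X} {s g s' g' : X → ℕ}
  {K K' : CGraph ar}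

/-- The addresses of the edges. -/
def addrs (D : PreGraph L X) : Set X := PreEdge.addr '' D.edges

theorem addr_mem_addrs {e : PreEdge L X} (he : e ∈ D.edges) : e.addr ∈ D.addrs := ⟨e, he, rfl⟩

/-- The counterparts of the conditions on c-graphs. -/
structure WF (ar : L → ℕ) (D : PreGraph L X) : Prop where
  verts_finite : D.verts.Finite
  edges_finite : D.edges.Finite
  addr_inj : Set.InjOn PreEdge.addr D.edges
  att_length : ∀ e ∈ D.edges, e.att.length = ar e.lab
  att_mem : ∀ e ∈ D.edges, ∀ x ∈ e.att, x ∈ D.verts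
  src_mem : ∀ x ∈ D.src, x ∈ D.verts
  src_nodup : D.src.Nodup

/-- The c-graph `K` is the image of `D` under the injective renamings `s` of vertices and `g` of
addresses. -/
structure Realizes (D : PreGraph L X) (s g : X → ℕ) (K : CGraph ar) : Prop where
  s_inj : Set.InjOn s D.verts
  g_inj : Set.InjOn g D.addrs
  verts : K.verts = s '' D.verts
  edges : K.edges = PreEdge.real s g '' D.edges
  src : K.src = D.src.map s

/-- The c-graph `K` is the image of `D` under some injective renamings. -/
def IsCopy (D : PreGraph L X) (K : CGraph ar) : Prop := ∃ s g, D.Realizes s g K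

theorem WF.image_real_congr (hD : D.WF ar) (hs : Set.EqOn s s' D.verts)
    (hg : Set.EqOn g g' D.addrs) :
    PreEdge.real s g '' D.edges = PreEdge.real s' g' '' D.edges :=
  Set.image_congr fun e he =>
    PreEdge.real_congr (fun x hx => hs (hD.att_mem e he x hx)) (hg (addr_mem_addrs he))

theorem WF.map_src_congr (hD : D.WF ar) (hs : Set.EqOn s s' D.verts) :
    D.src.map s = D.src.map s' :=
  List.map_congr_left fun x hx => hs (hD.src_mem x hx)

theorem WF.exists_realizes (hD : D.WF ar) (hs : Set.InjOn s D.verts) (hg : Set.InjOn g D.addrs) :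
    ∃ K : CGraph ar, D.Realizes s g K := by
  refine ⟨⟨s '' D.verts, PreEdge.real s g '' D.edges, D.src.map s, hD.verts_finite.image _,
    hD.edges_finite.image _, ?_, ?_, ?_, ?_, ?_⟩, hs, hg, rfl, rfl, rfl⟩
  · rintro _ ⟨e, he, rfl⟩ _ ⟨e', he', rfl⟩ h
    rw [hD.addr_inj he he' (hg (addr_mem_addrs he) (addr_mem_addrs he') h)]
  · rintro _ ⟨e, he, rfl⟩
    simpa only [PreEdge.real, List.length_map] using hD.att_length e he
  · rintro _ ⟨e, he, rfl⟩ x hx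
    obtain ⟨y, hy, rfl⟩ := List.mem_map.1 hx
    exact ⟨y, hD.att_mem e he y hy, rfl⟩
  · intro x hx
    obtain ⟨y, hy, rfl⟩ := List.mem_map.1 hx
    exact ⟨y, hD.src_mem y hy, rfl⟩
  · exact hD.src_nodup.map_on fun x hx y hy h => hs (hD.src_mem x hx) (hD.src_mem y hy) h

theorem Realizes.ids (h : D.Realizes s g K) : K.ids = g '' D.addrs := by
  rw [CGraph.ids, h.edges, PreEdge.image_id_image_real, addrs]

theorem Realizes.congr (hD : D.WF ar) (h : D.Realizes s g K) (hs : Set.EqOn s' s D.verts)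
    (hg : Set.EqOn g' g D.addrs) : D.Realizes s' g' K where
  s_inj := h.s_inj.congr hs.symm
  g_inj := h.g_inj.congr hg.symm
  verts := h.verts.trans hs.image_eq.symm
  edges := h.edges.trans (hD.image_real_congr hs hg).symm
  src := h.src.trans (hD.map_src_congr hs).symm

theorem Realizes.unique (h : D.Realizes s g K) (h' : D.Realizes s g K') : K = K' :=
  CGraph.ext (h.verts.trans h'.verts.symm) (h.edges.trans h'.edges.symm) (h.src.trans h'.src.symm)

theorem IsCopy.of_iso (h : D.IsCopy K) (hK : K.Iso K') : D.IsCopy K' := by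
  obtain ⟨s, g, h⟩ := h
  obtain ⟨f, k, hf, hk, hverts, hedges, hsrc⟩ := hK
  rw [h.verts] at hf hverts
  rw [h.ids] at hk
  rw [h.edges] at hedges
  refine ⟨f ∘ s, k ∘ g, hf.comp h.s_inj (Set.mapsTo_image _ _),
    hk.comp h.g_inj (Set.mapsTo_image _ _), ?_, ?_, ?_⟩
  · rw [hverts, Set.image_comp]
  · rw [hedges, PreEdge.real_comp, Set.image_comp]
  · rw [hsrc, h.src, List.map_map]

theorem IsCopy.iso (hD : D.WF ar) (h : D.IsCopy K) (h' : D.IsCopy K') : K.Iso K' := by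
  obtain ⟨s, g, h⟩ := h
  obtain ⟨s', g', h'⟩ := h'
  obtain ⟨f, hf⟩ := exists_eqOn_comp_of_injOn h.s_inj s'
  obtain ⟨k, hk⟩ := exists_eqOn_comp_of_injOn h.g_inj g'
  refine ⟨f, k, ?_, ?_, ?_, ?_, ?_⟩
  · rw [h.verts]
    exact (h'.s_inj.congr hf.symm).image_of_comp
  · rw [h.ids]
    exact (h'.g_inj.congr hk.symm).image_of_comp
  · rw [h.verts, h'.verts, ← Set.image_comp, hf.image_eq]
  · rw [h.edges, h'.edges, ← hD.image_real_congr hf hk, PreEdge.real_comp, Set.image_comp]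
  · rw [h.src, h'.src, List.map_map, hD.map_src_congr hf]

/-- The hypergraph without edges whose vertices are its sources. -/
def discrete (l : List X) : PreGraph L X := ⟨{x | x ∈ l}, ∅, l⟩

theorem wf_discrete {l : List X} (hl : l.Nodup) : (discrete l : PreGraph L X).WF ar where
  verts_finite := l.finite_toSet
  edges_finite := Set.finite_empty
  addr_inj := Set.injOn_empty _
  att_length := by simp [discrete]
  att_mem := by simp [discrete]
  src_mem := fun _ hx => hx
  src_nodup := hl

end PreGraph

/-! ## Gluing graphs along their sources -/

/-- `K` is the union of `G` and of graphs `H i` that share exactly their sources with `G`, share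
with each other only vertices of `G`, and share no edges. Both parallel composition and substitution
of edges amount to this up to isomorphism of the `H i`. -/
structure CGraph.IsGluing {Λ : Type u} {ar : Λ → ℕ} {ι : Type*} (G : CGraph ar)
    (H : ι → CGraph ar) (K : CGraph ar) : Prop where
  verts_inter : ∀ i, (H i).verts ∩ G.verts = {x | x ∈ (H i).src}
  verts_inter_subset : ∀ i j, i ≠ j → (H i).verts ∩ (H j).verts ⊆ G.verts
  disjoint_ids : ∀ i, Disjoint (H i).ids G.ids
  pairwise_disjoint_ids : ∀ i j, i ≠ j → Disjoint (H i).ids (H j).ids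
  verts_eq : K.verts = G.verts ∪ ⋃ i, (H i).verts
  edges_eq : K.edges = G.edges ∪ ⋃ i, (H i).edges
  src_eq : K.src = G.src

theorem CGraph.isPar_iff_isGluing {Λ : Type u} {ar : Λ → ℕ} {G H K : CGraph ar} :
    G.IsPar H K ↔ ∃ G' H' : CGraph ar, G.Iso G' ∧ H.Iso H' ∧ H'.src = G'.src ∧
      G'.IsGluing (fun _ : Unit => H') K := by
  refine exists₂_congr fun G' H' => ⟨?_, ?_⟩
  · rintro ⟨hG, hH, hsrc, hverts, hids, hKv, hKe, hKs⟩
    refine ⟨hG, hH, hsrc.symm, fun _ => ?_, fun i j hij => absurd rfl hij, fun _ => hids.symm,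
      fun i j hij => absurd rfl hij, ?_, ?_, hKs⟩
    · rw [Set.inter_comm, hverts, hsrc]
    · rw [hKv, Set.iUnion_const]
    · rw [hKe, Set.iUnion_const]
  · rintro ⟨hG, hH, hsrc, hK⟩
    refine ⟨hG, hH, hsrc.symm, ?_, (hK.disjoint_ids ()).symm, ?_, ?_, hK.src_eq⟩
    · rw [Set.inter_comm, hK.verts_inter (), hsrc]
    · rw [hK.verts_eq, Set.iUnion_const]
    · rw [hK.edges_eq, Set.iUnion_const]

namespace PreGraph

variable {L : Type u} {ar : L → ℕ} {X : Type v} {ι : Type*} {D₀ : PreGraph L X}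
  {D : ι → PreGraph L X} {K : CGraph ar}

/-- The union of `D₀` and of the graphs `D i`, with the sources of `D₀`. -/
def glue (D₀ : PreGraph L X) (D : ι → PreGraph L X) : PreGraph L X :=
  ⟨D₀.verts ∪ ⋃ i, (D i).verts, D₀.edges ∪ ⋃ i, (D i).edges, D₀.src⟩

/-- The counterpart of the conditions in `CGraph.IsGluing`. -/
structure Gluable (D₀ : PreGraph L X) (D : ι → PreGraph L X) : Prop where
  verts_inter : ∀ i, (D i).verts ∩ D₀.verts = {x | x ∈ (D i).src}
  verts_inter_subset : ∀ i j, i ≠ j → (D i).verts ∩ (D j).verts ⊆ D₀.verts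
  disjoint_addrs : ∀ i, Disjoint (D i).addrs D₀.addrs
  pairwise_disjoint_addrs : ∀ i j, i ≠ j → Disjoint (D i).addrs (D j).addrs

theorem addrs_glue (D₀ : PreGraph L X) (D : ι → PreGraph L X) :
    (D₀.glue D).addrs = D₀.addrs ∪ ⋃ i, (D i).addrs := by
  simp only [addrs, glue, Set.image_union, Set.image_iUnion]

theorem Gluable.src_mem (hglue : Gluable D₀ D) (i : ι) : ∀ x ∈ (D i).src, x ∈ D₀.verts :=
  fun _ hx => ((hglue.verts_inter i).ge hx).2

theorem Gluable.addr_injOn (hglue : Gluable D₀ D) (h₀ : Set.InjOn PreEdge.addr D₀.edges)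
    (h : ∀ i, Set.InjOn PreEdge.addr (D i).edges) :
    Set.InjOn PreEdge.addr (D₀.glue D).edges := by
  rintro e (he | he) e' (he' | he') hee
  · exact h₀ he he' hee
  · obtain ⟨i, hi⟩ := Set.mem_iUnion.1 he'
    exact ((hglue.disjoint_addrs i).ne_of_mem (addr_mem_addrs hi) (addr_mem_addrs he) hee.symm).elim
  · obtain ⟨i, hi⟩ := Set.mem_iUnion.1 he
    exact ((hglue.disjoint_addrs i).ne_of_mem (addr_mem_addrs hi) (addr_mem_addrs he') hee).elim
  · obtain ⟨i, hi⟩ := Set.mem_iUnion.1 he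
    obtain ⟨j, hj⟩ := Set.mem_iUnion.1 he'
    obtain rfl | hij := eq_or_ne i j
    · exact h i hi hj hee
    · exact ((hglue.pairwise_disjoint_addrs i j hij).ne_of_mem (addr_mem_addrs hi)
        (addr_mem_addrs hj) hee).elim

theorem Gluable.wf [Finite ι] (hglue : Gluable D₀ D) (h₀ : D₀.WF ar) (h : ∀ i, (D i).WF ar) :
    (D₀.glue D).WF ar where
  verts_finite := h₀.verts_finite.union (Set.finite_iUnion fun i => (h i).verts_finite)
  edges_finite := h₀.edges_finite.union (Set.finite_iUnion fun i => (h i).edges_finite)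
  addr_inj := hglue.addr_injOn h₀.addr_inj fun i => (h i).addr_inj
  att_length := by
    rintro e (he | he)
    · exact h₀.att_length e he
    · obtain ⟨i, hi⟩ := Set.mem_iUnion.1 he
      exact (h i).att_length e hi
  att_mem := by
    rintro e (he | he) x hx
    · exact Or.inl (h₀.att_mem e he x hx)
    · obtain ⟨i, hi⟩ := Set.mem_iUnion.1 he
      exact Or.inr (Set.mem_iUnion.2 ⟨i, (h i).att_mem e hi x hx⟩)
  src_mem := fun x hx => Or.inl (h₀.src_mem x hx)
  src_nodup := h₀.src_nodup

theorem Realizes.exists_isGluing {s g : X → ℕ} (hK : (D₀.glue D).Realizes s g K)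
    (hglue : Gluable D₀ D) (h₀ : D₀.WF ar) (h : ∀ i, (D i).WF ar) :
    ∃ (G : CGraph ar) (H : ι → CGraph ar), D₀.Realizes s g G ∧ (∀ i, (D i).Realizes s g (H i)) ∧
      G.IsGluing H K := by
  have hverts : ∀ i, (D i).verts ⊆ (D₀.glue D).verts := fun i =>
    (Set.subset_iUnion (fun i => (D i).verts) i).trans Set.subset_union_right
  have haddrs : ∀ i, (D i).addrs ⊆ (D₀.glue D).addrs := fun i => by
    rw [addrs_glue]
    exact (Set.subset_iUnion (fun i => (D i).addrs) i).trans Set.subset_union_right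
  have haddrs₀ : D₀.addrs ⊆ (D₀.glue D).addrs := by
    rw [addrs_glue]
    exact Set.subset_union_left
  obtain ⟨G, hG⟩ := h₀.exists_realizes (hK.s_inj.mono Set.subset_union_left)
    (hK.g_inj.mono haddrs₀)
  choose H hH using fun i => (h i).exists_realizes (hK.s_inj.mono (hverts i))
    (hK.g_inj.mono (haddrs i))
  refine ⟨G, H, hG, hH, fun i => ?_, fun i j hij => ?_, fun i => ?_, fun i j hij => ?_, ?_, ?_, ?_⟩
  · rw [(hH i).verts, hG.verts, ← hK.s_inj.image_inter (hverts i) Set.subset_union_left,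
      hglue.verts_inter, (hH i).src]
    ext a
    simp only [Set.mem_image, Set.mem_ofPred_eq, List.mem_map]
  · rw [(hH i).verts, (hH j).verts, hG.verts, ← hK.s_inj.image_inter (hverts i) (hverts j)]
    exact Set.image_mono (hglue.verts_inter_subset i j hij)
  · rw [(hH i).ids, hG.ids]
    exact disjoint_image_image_of_injOn hK.g_inj (haddrs i) haddrs₀ (hglue.disjoint_addrs i)
  · rw [(hH i).ids, (hH j).ids]
    exact disjoint_image_image_of_injOn hK.g_inj (haddrs i) (haddrs j)
      (hglue.pairwise_disjoint_addrs i j hij)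
  · simp only [hK.verts, hG.verts, (hH _).verts, glue, Set.image_union, Set.image_iUnion]
  · simp only [hK.edges, hG.edges, (hH _).edges, glue, Set.image_union, Set.image_iUnion]
  · rw [hK.src, hG.src, glue]

theorem isCopy_glue_of_isGluing (hglue : Gluable D₀ D) (h₀ : D₀.WF ar) (h : ∀ i, (D i).WF ar)
    {s₀ g₀ : X → ℕ} {s g : ι → X → ℕ} {G : CGraph ar} {H : ι → CGraph ar}
    (hG : D₀.Realizes s₀ g₀ G) (hH : ∀ i, (D i).Realizes (s i) (g i) (H i))
    (hsrc : ∀ i, (H i).src = (D i).src.map s₀) (hK : G.IsGluing H K) : (D₀.glue D).IsCopy K := by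
  have hmap : ∀ i, ∀ x ∈ (D i).src, s i x = s₀ x := fun i =>
    List.map_inj_left.1 ((hH i).src.symm.trans (hsrc i))
  obtain ⟨S, hS₀, hS, hSinj⟩ := exists_injOn_amalgam hG.s_inj (fun i => (hH i).s_inj)
    (fun i x hx => (hmap i x ((hglue.verts_inter i).le hx.symm)).symm)
    hglue.verts_inter_subset
    (fun i => by
      rw [← hG.verts, ← (hH i).verts, Set.inter_comm, hK.verts_inter, Set.inter_comm,
        hglue.verts_inter, hsrc]
      intro a ha
      exact List.mem_map.1 ha)
    (fun i j hij => by
      rw [← hG.verts, ← (hH i).verts, ← (hH j).verts]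
      exact hK.verts_inter_subset i j hij)
  obtain ⟨A, hA₀, hA, hAinj⟩ := exists_injOn_amalgam hG.g_inj (fun i => (hH i).g_inj)
    (fun i x hx => (Set.disjoint_left.1 (hglue.disjoint_addrs i) hx.2 hx.1).elim)
    (fun i j hij x hx =>
      (Set.disjoint_left.1 (hglue.pairwise_disjoint_addrs i j hij) hx.1 hx.2).elim)
    (fun i x hx => by
      rw [← hG.ids, ← (hH i).ids] at hx
      exact (Set.disjoint_left.1 (hK.disjoint_ids i) hx.2 hx.1).elim)
    (fun i j hij x hx => by
      rw [← (hH i).ids, ← (hH j).ids] at hx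
      exact (Set.disjoint_left.1 (hK.pairwise_disjoint_ids i j hij) hx.1 hx.2).elim)
  refine ⟨S, A, hSinj, (addrs_glue D₀ D).symm ▸ hAinj, ?_, ?_, ?_⟩
  · simp only [hK.verts_eq, hG.verts, (hH _).verts, glue, Set.image_union, Set.image_iUnion,
      hS₀.image_eq, (hS _).image_eq]
  · simp only [hK.edges_eq, hG.edges, (hH _).edges, glue, Set.image_union, Set.image_iUnion,
      h₀.image_real_congr hS₀ hA₀, (h _).image_real_congr (hS _) (hA _)]
  · rw [hK.src_eq, hG.src, glue, h₀.map_src_congr hS₀]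

theorem isCopy_glue_iff_isPar {D₁ D₂ : PreGraph L X} (hglue : Gluable D₁ fun _ : Unit => D₂)
    (hsrc : D₂.src = D₁.src) (h₁ : D₁.WF ar) (h₂ : D₂.WF ar) {K₁ K₂ : CGraph ar}
    (hK₁ : D₁.IsCopy K₁) (hK₂ : D₂.IsCopy K₂) :
    (D₁.glue fun _ : Unit => D₂).IsCopy K ↔ K₁.IsPar K₂ K := by
  rw [CGraph.isPar_iff_isGluing]
  constructor
  · rintro ⟨s, g, hK⟩
    obtain ⟨G, H, hG, hH, hGH⟩ := hK.exists_isGluing hglue h₁ fun _ => h₂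
    refine ⟨G, H (), hK₁.iso h₁ ⟨s, g, hG⟩, hK₂.iso h₂ ⟨s, g, hH ()⟩, ?_, hGH⟩
    rw [(hH ()).src, hG.src, hsrc]
  · rintro ⟨K₁', K₂', iso₁, iso₂, hsrc', hK⟩
    obtain ⟨s₁, g₁, hK₁'⟩ := hK₁.of_iso iso₁
    obtain ⟨s₂, g₂, hK₂'⟩ := hK₂.of_iso iso₂
    exact isCopy_glue_of_isGluing hglue h₁ (fun _ => h₂) hK₁' (fun _ => hK₂')
      (fun _ => by rw [hsrc', hsrc, hK₁'.src]) hK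

end PreGraph

/-- The subgraph consisting of all vertices and of the terminal edges. -/
def HRRhs.terminalPart {L : Type u} {ar : L → ℕ} {N : Type v} {arN : N → ℕ}
    (G : CGraph (Sum.elim ar arN)) : CGraph ar where
  verts := G.verts
  edges := termEdges G
  src := G.src
  verts_finite := G.verts_finite
  edges_finite := G.edges_finite.preimage
    (f := fun e : HEdge L => (⟨e.id, Sum.inl e.lab, e.att⟩ : HEdge (L ⊕ N)))
    (by rintro ⟨i, r, a⟩ - ⟨j, q, b⟩ - h; simpa using h)
  id_inj := fun ⟨i, r, a⟩ he ⟨j, q, b⟩ he' h => by simpa using G.id_inj _ he _ he' h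
  att_length := fun e he => G.att_length _ he
  att_mem := fun e he => G.att_mem _ he
  src_mem := G.src_mem
  src_nodup := G.src_nodup

theorem HRRhs.isSubst_iff_isGluing {L : Type u} {ar : L → ℕ} {N : Type v} {arN : N → ℕ}
    {G : CGraph (Sum.elim ar arN)} {es : List (HEdge N)} {k : ℕ} {H : Fin k → CGraph ar}
    {K : CGraph ar} :
    IsSubst G es H K ↔ ∃ (hk : es.length = k) (H' : Fin k → CGraph ar), (∀ i, (H i).Iso (H' i)) ∧
      (∀ i, (H' i).src = (es.get (i.cast hk.symm)).att) ∧ (terminalPart G).IsGluing H' K :=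
  exists₂_congr fun _ _ => and_congr_right fun _ => and_congr_right fun _ =>
    ⟨fun ⟨h₁, h₂, h₃, h₄, h₅, h₆, h₇⟩ => ⟨h₁, h₂, h₃, h₄, h₅, h₆, h₇⟩,
      fun ⟨h₁, h₂, h₃, h₄, h₅, h₆, h₇⟩ => ⟨h₁, h₂, h₃, h₄, h₅, h₆, h₇⟩⟩

namespace PreGraph

section Substitution

variable {L : Type u} {ar : L → ℕ} {N : Type*} {arN : N → ℕ} {X : Type v} {D₀ : PreGraph L X}
  {k : ℕ} {D : Fin k → PreGraph L X} {s₀ g₀ : X → ℕ} {G : CGraph (Sum.elim ar arN)}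
  {es : List (HEdge N)} {H : Fin k → CGraph ar}

theorem isCopy_glue_of_isSubst (hglue : Gluable D₀ D) (h₀ : D₀.WF ar) (h : ∀ i, (D i).WF ar)
    (hG : D₀.Realizes s₀ g₀ (HRRhs.terminalPart G)) (hk : es.length = k)
    (hatt : ∀ i, (es.get (i.cast hk.symm)).att = (D i).src.map s₀)
    (hH : ∀ i, (D i).IsCopy (H i)) {K : CGraph ar} (hK : HRRhs.IsSubst G es H K) :
    (D₀.glue D).IsCopy K := by
  obtain ⟨_, H', iso, hsrc, hK⟩ := HRRhs.isSubst_iff_isGluing.1 hK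
  choose s g hH' using fun i => (hH i).of_iso (iso i)
  exact isCopy_glue_of_isGluing hglue h₀ h hG hH' (fun i => (hsrc i).trans (hatt i)) hK

theorem exists_isSubst [Encodable X] (hglue : Gluable D₀ D) (h₀ : D₀.WF ar)
    (h : ∀ i, (D i).WF ar) (hG : D₀.Realizes s₀ g₀ (HRRhs.terminalPart G)) (hk : es.length = k)
    (hatt : ∀ i, (es.get (i.cast hk.symm)).att = (D i).src.map s₀)
    (hH : ∀ i, (D i).IsCopy (H i)) : ∃ K : CGraph ar, HRRhs.IsSubst G es H K := by
  obtain ⟨s, hs, s_inj⟩ := exists_injective_eqOn h₀.verts_finite hG.s_inj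
  obtain ⟨g, hg, g_inj⟩ := exists_injective_eqOn (h₀.edges_finite.image _) hG.g_inj
  obtain ⟨K, hK⟩ := (hglue.wf h₀ h).exists_realizes s_inj.injOn g_inj.injOn
  obtain ⟨G', H', hG', hH', hGH⟩ := hK.exists_isGluing hglue h₀ h
  obtain rfl : G' = HRRhs.terminalPart G := hG'.unique (hG.congr h₀ hs hg)
  refine ⟨K, HRRhs.isSubst_iff_isGluing.2
    ⟨hk, H', fun i => (hH i).iso (h i) ⟨s, g, hH' i⟩, fun i => ?_, hGH⟩⟩
  rw [(hH' i).src, hatt]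
  exact List.map_congr_left fun x hx => hs (hglue.src_mem i x hx)

end Substitution

end PreGraph

/-! ## Satisfaction in terms of relation atoms -/

namespace Atom

variable {L : Type u} {ar : L → ℕ} {V : Type v}

/-- The condition that an atom imposes on the store alone. -/
def PureHolds (s : V → ℕ) : Atom ar V → Prop
  | eq x y => s x = s y
  | neq x y => s x ≠ s y
  | rel _ _ => True

end Atom

/-- The subgraph of type `0` that consists of the edges in `F` and of their attached vertices. -/
def CGraph.edgeSubgraph {Λ : Type u} {ar : Λ → ℕ} (G : CGraph ar) (F : Set (HEdge Λ))
    (hF : F ⊆ G.edges) : CGraph ar where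
  verts := {x | ∃ e ∈ F, x ∈ e.att}
  edges := F
  src := []
  verts_finite := G.verts_finite.subset fun x ⟨e, he, hx⟩ => G.att_mem e (hF he) x hx
  edges_finite := G.edges_finite.subset hF
  id_inj := fun e he e' he' h => G.id_inj e (hF he) e' (hF he') h
  att_length := fun e he => G.att_length e (hF he)
  att_mem := fun e he _ hx => ⟨e, he, hx⟩
  src_mem := fun _ hx => absurd hx List.not_mem_nil
  src_nodup := List.nodup_nil

namespace PreEdge

variable {L : Type u} {ar : L → ℕ} {X : Type v}

/-- The vertices attached to a set of edges. -/
def attVerts (E : Set (PreEdge L X)) : Set X := {x | ∃ e ∈ E, x ∈ e.att}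

theorem attVerts_union (E F : Set (PreEdge L X)) : attVerts (E ∪ F) = attVerts E ∪ attVerts F := by
  ext x
  simp only [attVerts, Set.mem_ofPred_eq, Set.mem_union, or_and_right, exists_or]

theorem attVerts_iUnion {ι : Type*} (E : ι → Set (PreEdge L X)) :
    attVerts (⋃ i, E i) = ⋃ i, attVerts (E i) := by
  ext x
  simp only [attVerts, Set.mem_ofPred_eq, Set.mem_iUnion, ← exists_and_right]
  exact exists_comm

theorem att_image_real (s g : X → ℕ) (E : Set (PreEdge L X)) :
    {x | ∃ e ∈ real s g '' E, x ∈ e.att} = s '' attVerts E := by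
  ext x
  constructor
  · rintro ⟨_, ⟨e, he, rfl⟩, hx⟩
    obtain ⟨y, hy, rfl⟩ := List.mem_map.1 hx
    exact ⟨y, ⟨e, he, hy⟩, rfl⟩
  · rintro ⟨y, ⟨e, he, hy⟩, rfl⟩
    exact ⟨_, ⟨e, he, rfl⟩, List.mem_map.2 ⟨y, hy, rfl⟩⟩

/-- The c-graph `G` consists of one edge for each member of `E`, attached to the values under `s`,
and of the attached vertices. The store `s` may identify vertices. -/
def IsImage (s : X → ℕ) (E : Set (PreEdge L X)) (G : CGraph ar) : Prop :=
  ∃ g : X → ℕ, Set.InjOn g (addr '' E) ∧ G.verts = s '' attVerts E ∧ G.edges = real s g '' E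

theorem isImage_union_iff {s : X → ℕ} {E F : Set (PreEdge L X)} {G : CGraph ar}
    (hEF : Disjoint (addr '' E) (addr '' F)) :
    IsImage s (E ∪ F) G ↔ ∃ G₁ G₂ : CGraph ar, G₁.src = [] ∧ G₂.src = [] ∧
      Disjoint G₁.ids G₂.ids ∧ G.verts = G₁.verts ∪ G₂.verts ∧ G.edges = G₁.edges ∪ G₂.edges ∧
      IsImage s E G₁ ∧ IsImage s F G₂ := by
  constructor
  · rintro ⟨g, hg, hverts, hedges⟩
    rw [attVerts_union, Set.image_union] at hverts
    rw [Set.image_union] at hedges hg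
    refine ⟨G.edgeSubgraph (real s g '' E) (hedges ▸ Set.subset_union_left),
      G.edgeSubgraph (real s g '' F) (hedges ▸ Set.subset_union_right), rfl, rfl, ?_, ?_, hedges,
      ⟨g, hg.mono Set.subset_union_left, att_image_real s g E, rfl⟩,
      ⟨g, hg.mono Set.subset_union_right, att_image_real s g F, rfl⟩⟩
    · simp only [CGraph.ids, CGraph.edgeSubgraph, image_id_image_real]
      exact disjoint_image_image_of_injOn hg Set.subset_union_left Set.subset_union_right hEF
    · simp only [CGraph.edgeSubgraph, att_image_real, hverts]
  · rintro ⟨G₁, G₂, -, -, hids, hverts, hedges, ⟨g₁, hg₁, hv₁, he₁⟩, g₂, hg₂, hv₂, he₂⟩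
    rw [CGraph.ids, CGraph.ids, he₁, he₂, image_id_image_real, image_id_image_real] at hids
    obtain ⟨g, hgg₁, hgg₂, hg⟩ := exists_injOn_union_of_disjoint hg₁ hg₂ hEF hids
    have hreal : ∀ {E' : Set (PreEdge L X)} {g' : X → ℕ}, Set.EqOn g g' (addr '' E') →
        real s g '' E' = real s g' '' E' := fun h =>
      Set.image_congr fun e he => real_congr (fun _ _ => rfl) (h ⟨e, he, rfl⟩)
    refine ⟨g, by rwa [Set.image_union], ?_, ?_⟩
    · rw [hverts, hv₁, hv₂, attVerts_union, Set.image_union]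
    · rw [hedges, he₁, he₂, Set.image_union, hreal hgg₁, hreal hgg₂]

end PreEdge

namespace QFormula

variable {L : Type u} {ar : L → ℕ} {V : Type*} {X : Type v}

/-- The members of `E` are the occurrences of relation atoms in `φ`: these and the conditions on the
store determine the models of `φ`. -/
structure Describes (φ : QFormula ar X) (E : Set (PreEdge L X)) : Prop where
  sat_iff : ∀ (s : X → ℕ) (G : CGraph ar),
    φ.Sat s G ↔ (∀ a ∈ φ.atoms, a.PureHolds s) ∧ PreEdge.IsImage s E G
  exists_rel_mem : ∀ e ∈ E, ∃ xs, e.att = List.ofFn xs ∧ Atom.rel e.lab xs ∈ φ.atoms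

theorem isImage_empty_iff {s : X → ℕ} {G : CGraph ar} :
    PreEdge.IsImage s ∅ G ↔ G.verts = ∅ ∧ G.edges = ∅ := by
  simp [PreEdge.IsImage, PreEdge.attVerts]

theorem describes_emp : (emp : QFormula ar X).Describes ∅ where
  sat_iff s G := by simp [Sat, atoms, isImage_empty_iff]
  exists_rel_mem := by simp

theorem describes_eq (x y : X) : (atom (.eq x y) : QFormula ar X).Describes ∅ where
  sat_iff s G := by
    simp [Sat, Atom.Sat, Atom.PureHolds, atoms, isImage_empty_iff, and_comm, and_left_comm]
  exists_rel_mem := by simp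

theorem describes_neq (x y : X) : (atom (.neq x y) : QFormula ar X).Describes ∅ where
  sat_iff s G := by
    simp [Sat, Atom.Sat, Atom.PureHolds, atoms, isImage_empty_iff, and_comm, and_left_comm]
  exists_rel_mem := by simp

theorem describes_rel (r : L) (xs : Fin (ar r) → X) (a : X) :
    (atom (.rel r xs) : QFormula ar X).Describes {⟨a, r, List.ofFn xs⟩} where
  sat_iff s G := by
    have hverts : s '' PreEdge.attVerts {(⟨a, r, List.ofFn xs⟩ : PreEdge L X)} =
        Set.range fun i => s (xs i) := by
      ext a
      simp [PreEdge.attVerts]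
    simp only [Sat, Atom.Sat, atoms, PreEdge.IsImage, hverts, List.mem_singleton, forall_eq,
      Atom.PureHolds, true_and, Set.image_singleton, Set.injOn_singleton, PreEdge.real,
      List.map_ofFn]
    constructor
    · rintro ⟨h, k, hk⟩
      exact ⟨fun _ => k, h, hk⟩
    · rintro ⟨g, h, hk⟩
      exact ⟨h, g a, hk⟩
  exists_rel_mem := by simp [atoms]

theorem Describes.star {φ ψ : QFormula ar X} {E F : Set (PreEdge L X)} (hφ : φ.Describes E)
    (hψ : ψ.Describes F) (hEF : Disjoint (PreEdge.addr '' E) (PreEdge.addr '' F)) :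
    (φ.star ψ).Describes (E ∪ F) where
  sat_iff s G := by
    simp only [Sat, hφ.sat_iff, hψ.sat_iff, atoms, List.mem_append, or_imp, forall_and,
      PreEdge.isImage_union_iff hEF]
    constructor
    · rintro ⟨G₁, G₂, h₁, h₂, hids, hverts, hedges, ⟨pure₁, im₁⟩, pure₂, im₂⟩
      exact ⟨⟨pure₁, pure₂⟩, G₁, G₂, h₁, h₂, hids, hverts, hedges, im₁, im₂⟩
    · rintro ⟨⟨pure₁, pure₂⟩, G₁, G₂, h₁, h₂, hids, hverts, hedges, im₁, im₂⟩
      exact ⟨G₁, G₂, h₁, h₂, hids, hverts, hedges, ⟨pure₁, im₁⟩, pure₂, im₂⟩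
  exists_rel_mem := by
    rintro e (he | he)
    · obtain ⟨xs, h, h'⟩ := hφ.exists_rel_mem e he
      exact ⟨xs, h, List.mem_append_left _ h'⟩
    · obtain ⟨xs, h, h'⟩ := hψ.exists_rel_mem e he
      exact ⟨xs, h, List.mem_append_right _ h'⟩

theorem describes_bigStar {k : ℕ} (φ : Fin k → QFormula ar X) (E : Fin k → Set (PreEdge L X))
    (h : ∀ i, (φ i).Describes (E i))
    (hd : ∀ i j, i ≠ j → Disjoint (PreEdge.addr '' E i) (PreEdge.addr '' E j)) :
    (bigStar (List.ofFn φ)).Describes (⋃ i, E i) := by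
  induction k with
  | zero =>
    rw [List.ofFn_zero, Set.iUnion_of_empty]
    exact describes_emp
  | succ k ih =>
    have hE : ⋃ i, E i = E 0 ∪ ⋃ i : Fin k, E i.succ := by
      ext x
      simp only [Set.mem_iUnion, Set.mem_union, Fin.exists_fin_succ]
    rw [List.ofFn_succ, hE]
    refine (h 0).star (ih _ _ (fun i => h i.succ)
      fun i j hij => hd _ _ fun h => hij (Fin.succ_injective _ h)) ?_
    rw [Set.image_iUnion, Set.disjoint_iUnion_right]
    exact fun i => hd _ _ (Fin.succ_ne_zero i).symm

theorem mem_atoms_bigStar (l : List (QFormula ar X)) (a : Atom ar X) :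
    a ∈ (bigStar l).atoms ↔ ∃ φ ∈ l, a ∈ φ.atoms := by
  induction l with
  | nil => simp [bigStar, atoms]
  | cons φ l ih =>
    have hcons : (bigStar (φ :: l)).atoms = φ.atoms ++ (bigStar l).atoms := rfl
    rw [hcons, List.mem_append, ih]
    simp only [List.mem_cons, exists_eq_or_imp]

theorem atoms_subst (σ : V → X) (φ : QFormula ar V) :
    (φ.subst σ).atoms = φ.atoms.map (Atom.subst σ) := by
  induction φ with
  | emp => rfl
  | atom a => rfl
  | star φ ψ ihφ ihψ => simp only [subst, atoms, ihφ, ihψ, List.map_append]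

/-- The occurrences of relation atoms in `φ` under the substitution `σ`; the atom at position `i`
of `φ.atoms` has the address `α i`. -/
def relEdges (σ : V → X) (α : ℕ → X) (φ : QFormula ar V) : Set (PreEdge L X) :=
  {e | ∃ i r xs, φ.atoms[i]? = some (.rel r xs) ∧ e = ⟨α i, r, List.ofFn fun t => σ (xs t)⟩}

section RelEdges

variable (σ : V → X) (α : ℕ → X) (φ ψ : QFormula ar V)

theorem relEdges_star : relEdges σ α (φ.star ψ) =
    relEdges σ α φ ∪ relEdges σ (fun i => α (φ.atoms.length + i)) ψ := by
  ext e
  simp only [relEdges, atoms, Set.mem_ofPred_eq, Set.mem_union]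
  constructor
  · rintro ⟨i, r, xs, h, rfl⟩
    by_cases hi : i < φ.atoms.length
    · rw [List.getElem?_append_left hi] at h
      exact Or.inl ⟨i, r, xs, h, rfl⟩
    · rw [List.getElem?_append_right (not_lt.1 hi)] at h
      refine Or.inr ⟨_, r, xs, h, ?_⟩
      rw [Nat.add_sub_cancel' (not_lt.1 hi)]
  · rintro (⟨i, r, xs, h, rfl⟩ | ⟨i, r, xs, h, rfl⟩)
    · refine ⟨i, r, xs, ?_, rfl⟩
      obtain ⟨hi, -⟩ := List.getElem?_eq_some_iff.1 h
      rwa [List.getElem?_append_left hi]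
    · refine ⟨_, r, xs, ?_, rfl⟩
      rwa [List.getElem?_append_right (Nat.le_add_right _ _), Nat.add_sub_cancel_left]

theorem relEdges_atom_rel (r : L) (xs : Fin (ar r) → V) :
    relEdges σ α (atom (.rel r xs) : QFormula ar V) =
      {⟨α 0, r, List.ofFn fun t => σ (xs t)⟩} := by
  ext e
  constructor
  · rintro ⟨i, r', xs', h, rfl⟩
    rw [atoms, List.getElem?_singleton] at h
    split_ifs at h with hi
    subst hi
    cases h
    rfl
  · rintro rfl
    exact ⟨0, r, xs, rfl, rfl⟩

theorem relEdges_eq_empty {φ : QFormula ar V} (hφ : ∀ a ∈ φ.atoms, a.isRel = false) :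
    relEdges σ α φ = ∅ := by
  refine Set.eq_empty_of_forall_notMem ?_
  rintro _ ⟨i, r, xs, h, rfl⟩
  exact Bool.noConfusion (hφ _ (List.mem_of_getElem? h))

theorem addr_image_relEdges_subset :
    PreEdge.addr '' relEdges σ α φ ⊆ α '' {i | i < φ.atoms.length} := by
  rintro _ ⟨_, ⟨i, r, xs, h, rfl⟩, rfl⟩
  exact ⟨i, (List.getElem?_eq_some_iff.1 h).1, rfl⟩

variable {α}

theorem describes_subst (hα : Function.Injective α) :
    (φ.subst σ).Describes (relEdges σ α φ) := by
  induction φ generalizing α with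
  | emp =>
    rw [relEdges_eq_empty σ α (by simp [atoms])]
    exact describes_emp
  | atom a =>
    cases a with
    | eq x y =>
      rw [relEdges_eq_empty σ α (by simp [atoms, Atom.isRel])]
      exact describes_eq _ _
    | neq x y =>
      rw [relEdges_eq_empty σ α (by simp [atoms, Atom.isRel])]
      exact describes_neq _ _
    | rel r xs =>
      rw [relEdges_atom_rel]
      exact describes_rel r (fun t => σ (xs t)) (α 0)
  | star φ ψ ihφ ihψ =>
    rw [relEdges_star]
    refine (ihφ hα).star (ihψ fun i j h => Nat.add_left_cancel (hα h)) ?_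
    refine Set.disjoint_left.2 fun x hx hy => ?_
    obtain ⟨i, hi, rfl⟩ := addr_image_relEdges_subset σ α φ hx
    obtain ⟨j, -, hj⟩ := addr_image_relEdges_subset σ _ ψ hy
    have hij : φ.atoms.length + j = i := hα hj
    have hlt : i < φ.atoms.length := hi
    omega

theorem addr_injOn_relEdges (hα : Function.Injective α) :
    Set.InjOn PreEdge.addr (relEdges σ α φ) := by
  rintro _ ⟨i, r, xs, h, rfl⟩ _ ⟨j, r', xs', h', rfl⟩ hij
  obtain rfl : i = j := hα hij
  rw [h] at h'
  cases h'
  rfl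

theorem relEdges_finite (hα : Function.Injective α) : (relEdges σ α φ).Finite :=
  Set.Finite.of_finite_image
    (((Set.finite_lt_nat φ.atoms.length).image α).subset (addr_image_relEdges_subset σ α φ))
    (addr_injOn_relEdges σ φ hα)

variable {σ φ}

theorem att_length_of_mem_relEdges {e : PreEdge L X} (he : e ∈ relEdges σ α φ) :
    e.att.length = ar e.lab := by
  obtain ⟨i, r, xs, -, rfl⟩ := he
  exact List.length_ofFn

theorem mem_range_of_mem_att_relEdges {e : PreEdge L X} (he : e ∈ relEdges σ α φ) {x : X}
    (hx : x ∈ e.att) : x ∈ Set.range σ := by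
  obtain ⟨i, r, xs, -, rfl⟩ := he
  obtain ⟨t, rfl⟩ := List.mem_ofFn.1 hx
  exact ⟨xs t, rfl⟩

theorem exists_atom_of_mem_relEdges {e : PreEdge L X} (he : e ∈ relEdges σ α φ) :
    ∃ a ∈ φ.atoms, a.isRel = true ∧ ∀ z ∈ a.vars, σ z ∈ e.att := by
  obtain ⟨i, r, xs, h, rfl⟩ := he
  refine ⟨_, List.mem_of_getElem? h, rfl, ?_⟩
  rintro _ ⟨t, rfl⟩
  exact List.mem_ofFn.2 ⟨t, rfl⟩

variable (σ α)

theorem exists_mem_relEdges {a : Atom ar V} (ha : a ∈ φ.atoms) (hrel : a.isRel = true) :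
    ∃ e ∈ relEdges σ α φ, ∀ z ∈ a.vars, σ z ∈ e.att := by
  cases a with
  | eq x y => exact Bool.noConfusion hrel
  | neq x y => exact Bool.noConfusion hrel
  | rel r xs =>
    obtain ⟨i, hi⟩ := List.mem_iff_getElem?.1 ha
    refine ⟨_, ⟨i, r, xs, hi, rfl⟩, ?_⟩
    rintro _ ⟨t, rfl⟩
    exact List.mem_ofFn.2 ⟨t, rfl⟩

theorem exists_relEdges_eq_singleton {a : Atom ar V} (h : φ.atoms.filter Atom.isRel = [a]) :
    ∃ e, relEdges σ α φ = {e} ∧ ∀ z ∈ a.vars, σ z ∈ e.att := by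
  have eq_empty : ∀ (α' : ℕ → X) {ψ : QFormula ar V}, ψ.atoms.filter Atom.isRel = [] →
      relEdges σ α' ψ = ∅ := fun α' ψ hψ => relEdges_eq_empty σ α' fun b hb =>
    Bool.eq_false_iff.2 (List.filter_eq_nil_iff.1 hψ b hb)
  induction φ generalizing α with
  | emp => cases h
  | atom b =>
    have hmem : a ∈ List.filter Atom.isRel [b] := h ▸ List.mem_singleton_self a
    obtain ⟨hab, hrel⟩ := List.mem_filter.1 hmem
    obtain rfl := List.mem_singleton.1 hab
    obtain ⟨e, he, hatt⟩ := exists_mem_relEdges σ α (φ := atom a) hab hrel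
    refine ⟨e, ?_, hatt⟩
    cases a with
    | eq x y => exact Bool.noConfusion hrel
    | neq x y => exact Bool.noConfusion hrel
    | rel r xs =>
      rw [relEdges_atom_rel] at he ⊢
      rw [Set.mem_singleton_iff.1 he]
  | star φ ψ ihφ ihψ =>
    rw [atoms, List.filter_append, List.append_eq_singleton_iff] at h
    rw [relEdges_star]
    rcases h with ⟨hφ, hψ⟩ | ⟨hφ, hψ⟩
    · rw [eq_empty _ hφ, Set.empty_union]
      exact ihψ _ hψ
    · rw [eq_empty _ hψ, Set.union_empty]
      exact ihφ _ hφ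

variable (φ)

theorem image_real_relEdges (s g : X → ℕ) : PreEdge.real s g '' relEdges σ α φ =
    PreEdge.real id id '' relEdges (s ∘ σ) (g ∘ α) φ := by
  ext e
  constructor
  · rintro ⟨_, ⟨i, r, xs, h, rfl⟩, rfl⟩
    exact ⟨_, ⟨i, r, xs, h, rfl⟩, by
      simp only [PreEdge.real, List.map_ofFn, Function.comp_def, id]⟩
  · rintro ⟨_, ⟨i, r, xs, h, rfl⟩, rfl⟩
    exact ⟨_, ⟨i, r, xs, h, rfl⟩, by
      simp only [PreEdge.real, List.map_ofFn, Function.comp_def, id]⟩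

end RelEdges

end QFormula

/-! ## The hypergraph of a parse tree -/

theorem Atom.vars_subst {L : Type u} {ar : L → ℕ} {V W : Type*} (σ : V → W) (a : Atom ar V) :
    (a.subst σ).vars = σ '' a.vars := by
  cases a with
  | eq x y => exact (Set.image_pair σ x y).symm
  | neq x y => exact (Set.image_pair σ x y).symm
  | rel r xs => exact Set.range_comp σ xs

theorem InternalPath.exists_adj {V : Type*} {adj : V → V → Prop} {internal : V → Prop}
    {a b : V} (h : InternalPath adj internal a b) : ∃ c, adj a c := by
  cases h with
  | single _ _ h => exact ⟨_, h⟩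
  | cons _ _ _ h => exact ⟨_, h⟩

theorem SIDRule.RegularBody.occurs {L : Type u} {ar : L → ℕ} {P : Type v} {arP : P → ℕ}
    {ρ : SIDRule ar arP} (hρ : ρ.RegularBody)
    (z : Fin (arP ρ.head) ⊕ Fin ρ.m) :
    (∃ a ∈ ρ.psi.atoms, a.isRel = true ∧ z ∈ a.vars) ∨ ∃ c ∈ ρ.calls, z ∈ Set.range c.args := by
  obtain ⟨hbody, hpath⟩ := hρ
  by_cases hz : ∃ z', z ≠ z'
  · obtain ⟨z', hz'⟩ := hz
    obtain ⟨t, a, ha, hrel, hza, -⟩ := (hpath z z' hz').exists_adj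
    exact Or.inl ⟨a, ha, hrel, hza⟩
  push Not at hz
  rcases hbody with ⟨-, -, a, ha, hall⟩ | ⟨⟨a, ha, hrel⟩ | hne, hrels, hcalls⟩
  · obtain ⟨hmem, hrel⟩ := List.mem_filter.1 (ha ▸ List.mem_singleton_self a)
    exact Or.inl ⟨a, hmem, hrel, hall z⟩
  · obtain ⟨j, hj⟩ := hrels a ha hrel
    exact Or.inl ⟨a, ha, hrel, hz _ ▸ hj⟩
  · obtain ⟨c, hc⟩ := List.exists_mem_of_ne_nil _ hne
    obtain ⟨j, hj⟩ := hcalls c hc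
    exact Or.inr ⟨c, hc, hz _ ▸ hj⟩

namespace SID

section Addresses

/-- The variables whose address extends `p`. -/
def Below (p : List ℕ) : Set TVar := {x | p <:+ x.1}

theorem mk_mem_below (p : List ℕ) (j : ℕ) : ((p, j) : TVar) ∈ Below p := List.suffix_rfl

theorem below_cons_subset (c : ℕ) (p : List ℕ) : Below (c :: p) ⊆ Below p :=
  fun _ hx => (List.suffix_cons c p).trans hx

theorem disjoint_below_cons_below_cons {c d : ℕ} (hcd : c ≠ d) (p : List ℕ) :
    Disjoint (Below (c :: p)) (Below (d :: p)) := by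
  refine Set.disjoint_left.2 fun x hc hd => hcd ?_
  have hsuffix : c :: p <:+ d :: p := List.suffix_of_suffix_length_le hc hd le_rfl
  exact (List.cons_eq_cons.1 (hsuffix.eq_of_length rfl)).1

theorem disjoint_below_succ_below_succ {k : ℕ} {i j : Fin k} (hij : i ≠ j) (p : List ℕ) :
    Disjoint (Below (((i : ℕ) + 1) :: p)) (Below (((j : ℕ) + 1) :: p)) :=
  disjoint_below_cons_below_cons (fun h => hij (Fin.ext (Nat.succ_injective h))) p

theorem disjoint_below_cons_range_mk (c : ℕ) (p : List ℕ) :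
    Disjoint (Below (c :: p)) (Set.range (Prod.mk p)) := by
  refine Set.disjoint_left.2 ?_
  rintro _ hx ⟨j, rfl⟩
  exact Nat.not_succ_le_self _ (List.IsSuffix.length_le hx)

end Addresses

variable {L : Type u} {ar : L → ℕ} {P : Type v} {arP : P → ℕ}

/-- The actual arguments of the `i`-th predicate atom of a rule; empty if there is no such atom. -/
def callArgs (ρ : SIDRule ar arP) (args : List TVar) (p : List ℕ) (i : ℕ) : List TVar :=
  ((ρ.calls[i]?).map (fun c => List.ofFn (fun j => inst args p (c.args j)))).getD []

/-- The list `args` can serve as the actual arguments of a predicate of arity `n` without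
identifying parameters with each other or with the variables introduced at addresses extending
`p`. -/
structure FreshArgs (args : List TVar) (p : List ℕ) (n : ℕ) : Prop where
  length : args.length = n
  nodup : args.Nodup
  notMem : ∀ x ∈ args, x ∉ Below p

/-- The relation atoms and the variables that a single edge with address `p`, labelled by `ρ`,
contributes to the characteristic formula. -/
def bodyGraph (ρ : SIDRule ar arP) (args : List TVar) (p : List ℕ) : PreGraph L TVar :=
  ⟨Set.range (inst (n := arP ρ.head) (m := ρ.m) args p), ρ.psi.relEdges (inst args p) (Prod.mk p),
    args⟩

variable {Δ : SID ar arP}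

/-- The hypergraph whose vertices are the actual arguments and the variables introduced by the edges
of a tree, and whose edges are the occurrences of relation atoms in its characteristic formula. -/
def charGraph : PTree Δ.rules → List TVar → List ℕ → PreGraph L TVar
  | .leaf, args, _ => .discrete args
  | .edge ρ k sub rest, args, p =>
    ((bodyGraph ρ.1 args p).glue fun i : Fin k =>
      charGraph (sub i) (callArgs ρ.1 args p i) (((i : ℕ) + 1) :: p)).glue
    fun _ : Unit => charGraph rest args (0 :: p)

/-- The part of `charGraph` that stems from a single edge at the root and the subtrees at its
children. -/
def edgeGraph (ρ : SIDRule ar arP) {k : ℕ} (sub : Fin k → PTree Δ.rules) (args : List TVar)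
    (p : List ℕ) : PreGraph L TVar :=
  (bodyGraph ρ args p).glue fun i : Fin k =>
    charGraph (sub i) (callArgs ρ args p i) (((i : ℕ) + 1) :: p)

/-- All rules are productive, every predicate atom is unfolded, and the arities of the predicates
agree along the tree, whose root is labelled by a predicate of arity `n`. -/
def WellTyped : PTree Δ.rules → ℕ → Prop
  | .leaf, _ => True
  | .edge ρ k sub rest, n =>
    ¬ ρ.1.Unproductive ∧ arP ρ.1.head = n ∧ ρ.1.calls.length = k ∧
    (∀ i : Fin k, sub i ≠ .leaf ∧
      ∀ c, ρ.1.calls[(i : ℕ)]? = some c → WellTyped (sub i) (arP c.pred)) ∧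
    WellTyped rest n

theorem WellTyped.exists_call {ρ : Δ.rules} {k : ℕ} {sub : Fin k → PTree Δ.rules}
    {rest : PTree Δ.rules} {n : ℕ} (hT : WellTyped (.edge ρ k sub rest) n) (i : Fin k) :
    ∃ c, ρ.1.calls[(i : ℕ)]? = some c ∧ WellTyped (sub i) (arP c.pred) := by
  obtain ⟨-, -, hk, hsub, -⟩ := hT
  have hi : ρ.1.calls[(i : ℕ)]? = some (ρ.1.calls[(i : ℕ)]'(hk ▸ i.2)) :=
    List.getElem?_eq_getElem _
  exact ⟨_, hi, (hsub i).2 _ hi⟩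

theorem charGraph_src (T : PTree Δ.rules) (args : List TVar) (p : List ℕ) :
    (charGraph T args p).src = args := by
  cases T <;> rfl

section Arguments

variable {ρ : SIDRule ar arP} {args : List TVar} {p : List ℕ} {n m : ℕ}

theorem inst_inl_eq_getElem (h : args.length = n) (i : Fin n) :
    inst (m := m) args p (.inl i) = args[(i : ℕ)]'(h ▸ i.2) :=
  List.getD_eq_getElem _ _ _

theorem ofFn_inst_inl (h : args.length = n) :
    List.ofFn (fun i : Fin n => inst (m := m) args p (.inl i)) = args := by
  refine List.ext_getElem (by rw [List.length_ofFn, h]) fun i h₁ h₂ => ?_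
  rw [List.getElem_ofFn, inst_inl_eq_getElem h]

theorem FreshArgs.cons (h : FreshArgs args p n) (c : ℕ) : FreshArgs args (c :: p) n :=
  ⟨h.length, h.nodup, fun x hx hx' => h.notMem x hx (below_cons_subset c p hx')⟩

theorem FreshArgs.inst_injective (h : FreshArgs args p n) :
    Function.Injective (inst (n := n) (m := m) args p) := by
  have param_ne : ∀ (i : Fin n) (j : Fin m), inst (m := m) args p (.inl i) ≠ (p, (j : ℕ)) := by
    intro i j hij
    rw [inst_inl_eq_getElem h.length] at hij
    exact h.notMem _ (List.getElem_mem _) (hij ▸ mk_mem_below p j)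
  rintro (i | i) (j | j) hij
  · rw [inst_inl_eq_getElem h.length, inst_inl_eq_getElem h.length,
      h.nodup.getElem_inj_iff] at hij
    rw [Fin.ext hij]
  · exact (param_ne i j hij).elim
  · exact (param_ne j i hij.symm).elim
  · rw [Fin.ext (Prod.mk_right_injective p hij)]

theorem mem_bodyGraph_verts_of_mem_args (h : args.length = arP ρ.head) {x : TVar}
    (hx : x ∈ args) : x ∈ (bodyGraph ρ args p).verts := by
  rw [← ofFn_inst_inl (m := ρ.m) (p := p) h] at hx
  obtain ⟨i, rfl⟩ := List.mem_ofFn.1 hx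
  exact ⟨_, rfl⟩

theorem bodyGraph_verts_subset (h : args.length = arP ρ.head) :
    (bodyGraph ρ args p).verts ⊆ {x | x ∈ args} ∪ Set.range (Prod.mk p) := by
  rintro _ ⟨i | j, rfl⟩
  · rw [inst_inl_eq_getElem h]
    exact Or.inl (List.getElem_mem _)
  · exact Or.inr ⟨j, rfl⟩

theorem FreshArgs.disjoint_below_bodyGraph_verts (h : FreshArgs args p (arP ρ.head)) (c : ℕ) :
    Disjoint (Below (c :: p)) (bodyGraph ρ args p).verts :=
  (Set.disjoint_union_right.2 ⟨Set.disjoint_right.2 (h.cons c).notMem,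
    disjoint_below_cons_range_mk c p⟩).mono_right (bodyGraph_verts_subset h.length)

theorem wf_bodyGraph (h : FreshArgs args p (arP ρ.head)) : (bodyGraph ρ args p).WF ar where
  verts_finite := Set.finite_range _
  edges_finite := QFormula.relEdges_finite _ _ (Prod.mk_right_injective p)
  addr_inj := QFormula.addr_injOn_relEdges _ _ (Prod.mk_right_injective p)
  att_length := fun _ he => QFormula.att_length_of_mem_relEdges he
  att_mem := fun _ he _ hx => QFormula.mem_range_of_mem_att_relEdges he hx
  src_mem := fun _ hx => mem_bodyGraph_verts_of_mem_args h.length hx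
  src_nodup := h.nodup

variable {i : ℕ} {c : PredAtom arP (Fin (arP ρ.head) ⊕ Fin ρ.m)}

theorem callArgs_eq_ofFn (hc : ρ.calls[i]? = some c) (args : List TVar) (p : List ℕ) :
    callArgs ρ args p i = List.ofFn fun j => inst args p (c.args j) := by
  rw [callArgs, hc, Option.map_some, Option.getD_some]

theorem length_callArgs (hc : ρ.calls[i]? = some c) (args : List TVar) (p : List ℕ) :
    (callArgs ρ args p i).length = arP c.pred := by
  rw [callArgs_eq_ofFn hc, List.length_ofFn]

theorem mem_bodyGraph_verts_of_mem_callArgs {x : TVar} (hx : x ∈ callArgs ρ args p i) :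
    x ∈ (bodyGraph ρ args p).verts := by
  rcases hc : ρ.calls[i]? with _ | c
  · rw [callArgs, hc] at hx
    exact absurd hx List.not_mem_nil
  · rw [callArgs_eq_ofFn hc] at hx
    obtain ⟨j, rfl⟩ := List.mem_ofFn.1 hx
    exact ⟨_, rfl⟩

theorem FreshArgs.callArgs (h : FreshArgs args p (arP ρ.head)) (heq : ρ.EqualityFree)
    (hc : ρ.calls[i]? = some c) :
    FreshArgs (callArgs ρ args p i) ((i + 1) :: p) (arP c.pred) where
  length := length_callArgs hc args p
  nodup := by
    rw [callArgs_eq_ofFn hc]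
    exact List.nodup_ofFn.2 (h.inst_injective.comp (heq.2 c (List.mem_of_getElem? hc)))
  notMem := fun _ hx => Set.disjoint_right.1 (h.disjoint_below_bodyGraph_verts _)
    (mem_bodyGraph_verts_of_mem_callArgs hx)

end Arguments

section Addresses

variable (T rest : PTree Δ.rules) (ρ : SIDRule ar arP) {k : ℕ} (sub : Fin k → PTree Δ.rules)
  (args : List TVar) (p : List ℕ)

theorem bodyGraph_addrs_subset : (bodyGraph ρ args p).addrs ⊆ Set.range (Prod.mk p) :=
  (QFormula.addr_image_relEdges_subset _ _ _).trans (Set.image_subset_range _ _)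

theorem charGraph_addrs_subset : (charGraph T args p).addrs ⊆ Below p := by
  induction T generalizing args p with
  | leaf => simp only [charGraph, PreGraph.addrs, PreGraph.discrete, Set.image_empty,
      Set.empty_subset]
  | edge ρ k sub rest ihs ihr =>
    rw [charGraph, PreGraph.addrs_glue, PreGraph.addrs_glue, Set.iUnion_const]
    refine Set.union_subset (Set.union_subset ?_ (Set.iUnion_subset fun i =>
      (ihs i _ _).trans (below_cons_subset _ _))) ((ihr _ _).trans (below_cons_subset _ _))
    refine (bodyGraph_addrs_subset ρ.1 args p).trans ?_
    rintro _ ⟨j, rfl⟩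
    exact mk_mem_below p j

theorem disjoint_charGraph_addrs_bodyGraph_addrs (args' : List TVar) (c : ℕ) :
    Disjoint (charGraph T args' (c :: p)).addrs (bodyGraph ρ args p).addrs :=
  (disjoint_below_cons_range_mk c p).mono (charGraph_addrs_subset _ _ _)
    (bodyGraph_addrs_subset _ _ _)

theorem disjoint_charGraph_addrs_edgeGraph_addrs :
    Disjoint (charGraph rest args (0 :: p)).addrs (edgeGraph ρ sub args p).addrs := by
  rw [edgeGraph, PreGraph.addrs_glue, Set.disjoint_union_right, Set.disjoint_iUnion_right]
  exact ⟨disjoint_charGraph_addrs_bodyGraph_addrs _ _ _ _ _ _, fun i =>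
    (disjoint_below_cons_below_cons (Nat.succ_ne_zero i).symm p).mono (charGraph_addrs_subset _ _ _)
      (charGraph_addrs_subset _ _ _)⟩

theorem pairwise_disjoint_charGraph_addrs (i j : Fin k) (hij : i ≠ j) :
    Disjoint (charGraph (sub i) (callArgs ρ args p i) (((i : ℕ) + 1) :: p)).addrs
      (charGraph (sub j) (callArgs ρ args p j) (((j : ℕ) + 1) :: p)).addrs :=
  (disjoint_below_succ_below_succ hij p).mono (charGraph_addrs_subset _ _ _)
    (charGraph_addrs_subset _ _ _)

theorem describes_charFormAux : (charFormAux T args p).Describes (charGraph T args p).edges := by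
  induction T generalizing args p with
  | leaf => exact QFormula.describes_emp
  | edge ρ k sub rest ihs ihr =>
    have hbody : (ρ.1.psi.subst (inst args p)).Describes (bodyGraph ρ.1 args p).edges :=
      QFormula.describes_subst _ _ (Prod.mk_right_injective p)
    have hsub := QFormula.describes_bigStar _ _ (fun i => ihs i (callArgs ρ.1 args p i) _)
      (pairwise_disjoint_charGraph_addrs ρ.1 sub args p)
    have hrest := disjoint_charGraph_addrs_edgeGraph_addrs rest ρ.1 sub args p
    rw [edgeGraph, PreGraph.addrs_glue, Set.disjoint_union_right] at hrest
    simp only [charGraph, PreGraph.glue, Set.iUnion_const, Set.union_assoc]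
    refine hbody.star (hsub.star (ihr _ _) ?_) ?_
    · rw [Set.image_iUnion]
      exact hrest.2.symm
    · rw [Set.image_union, Set.image_iUnion, Set.disjoint_union_right, Set.disjoint_iUnion_right]
      exact ⟨fun i => (disjoint_charGraph_addrs_bodyGraph_addrs _ _ _ _ _ _).symm, hrest.1.symm⟩

end Addresses

section Vertices

variable {T : PTree Δ.rules} {ρ : Δ.rules} {k : ℕ} {sub : Fin k → PTree Δ.rules}
  {rest : PTree Δ.rules} {n : ℕ} {args : List TVar} {p : List ℕ}

theorem mem_charGraph_verts_of_mem_args (hT : WellTyped T n) (h : args.length = n) {x : TVar}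
    (hx : x ∈ args) : x ∈ (charGraph T args p).verts := by
  cases T with
  | leaf => exact hx
  | edge ρ k sub rest =>
    exact Or.inl (Or.inl (mem_bodyGraph_verts_of_mem_args (h.trans hT.2.1.symm) hx))

theorem charGraph_verts_subset (hT : WellTyped T n) (h : args.length = n) :
    (charGraph T args p).verts ⊆ {x | x ∈ args} ∪ Below p := by
  induction T generalizing args p n with
  | leaf => exact Set.subset_union_left
  | edge ρ k sub rest ihs ihr =>
    have hbody : (bodyGraph ρ.1 args p).verts ⊆ {x | x ∈ args} ∪ Below p := by
      refine (bodyGraph_verts_subset (h.trans hT.2.1.symm)).trans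
        (Set.union_subset_union_right _ ?_)
      rintro _ ⟨j, rfl⟩
      exact mk_mem_below p j
    refine Set.union_subset (Set.union_subset hbody (Set.iUnion_subset fun i => ?_))
      (Set.iUnion_subset fun _ =>
        (ihr hT.2.2.2.2 h).trans (Set.union_subset_union_right _ (below_cons_subset _ _)))
    obtain ⟨c, hc, hsub⟩ := hT.exists_call i
    exact (ihs i hsub (length_callArgs hc args p)).trans (Set.union_subset
      (fun x hx => hbody (mem_bodyGraph_verts_of_mem_callArgs hx))
      ((below_cons_subset _ _).trans Set.subset_union_right))

theorem charGraph_sub_verts_subset (hT : WellTyped (.edge ρ k sub rest) n) (i : Fin k) :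
    (charGraph (sub i) (callArgs ρ.1 args p i) (((i : ℕ) + 1) :: p)).verts ⊆
      {x | x ∈ callArgs ρ.1 args p i} ∪ Below (((i : ℕ) + 1) :: p) := by
  obtain ⟨c, hc, hsub⟩ := hT.exists_call i
  exact charGraph_verts_subset hsub (length_callArgs hc args p)

theorem gluable_bodyGraph (hT : WellTyped (.edge ρ k sub rest) n) (h : FreshArgs args p n) :
    (bodyGraph ρ.1 args p).Gluable fun i : Fin k =>
      charGraph (sub i) (callArgs ρ.1 args p i) (((i : ℕ) + 1) :: p) := by
  obtain rfl : arP ρ.1.head = n := hT.2.1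
  refine ⟨fun i => ?_, fun i j hij x hx => ?_, fun i =>
    disjoint_charGraph_addrs_bodyGraph_addrs _ _ _ _ _ _,
    pairwise_disjoint_charGraph_addrs ρ.1 sub args p⟩
  · rw [charGraph_src]
    refine Set.Subset.antisymm (fun x hx => ?_) fun x hx => ⟨?_, ?_⟩
    · exact (charGraph_sub_verts_subset hT i hx.1).resolve_right fun hb =>
        Set.disjoint_left.1 (h.disjoint_below_bodyGraph_verts _) hb hx.2
    · obtain ⟨c, hc, hsub⟩ := hT.exists_call i
      exact mem_charGraph_verts_of_mem_args hsub (length_callArgs hc args p) hx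
    · exact mem_bodyGraph_verts_of_mem_callArgs hx
  · rcases charGraph_sub_verts_subset hT i hx.1 with hi | hi
    · exact mem_bodyGraph_verts_of_mem_callArgs hi
    rcases charGraph_sub_verts_subset hT j hx.2 with hj | hj
    · exact mem_bodyGraph_verts_of_mem_callArgs hj
    · exact (Set.disjoint_left.1 (disjoint_below_succ_below_succ hij p) hi hj).elim

theorem disjoint_below_edgeGraph_verts (hT : WellTyped (.edge ρ k sub rest) n)
    (h : FreshArgs args p n) : Disjoint (Below (0 :: p)) (edgeGraph ρ.1 sub args p).verts := by
  obtain rfl : arP ρ.1.head = n := hT.2.1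
  have hbody : Disjoint (Below (0 :: p)) (bodyGraph ρ.1 args p).verts :=
    h.disjoint_below_bodyGraph_verts 0
  refine Set.disjoint_union_right.2 ⟨hbody, Set.disjoint_iUnion_right.2 fun i => ?_⟩
  refine Disjoint.mono_right (charGraph_sub_verts_subset hT i) (Set.disjoint_union_right.2
    ⟨hbody.mono_right fun x hx => mem_bodyGraph_verts_of_mem_callArgs hx,
      disjoint_below_cons_below_cons (Nat.succ_ne_zero i).symm p⟩)

theorem gluable_edgeGraph (hT : WellTyped (.edge ρ k sub rest) n) (h : FreshArgs args p n) :
    (edgeGraph ρ.1 sub args p).Gluable fun _ : Unit => charGraph rest args (0 :: p) := by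
  refine ⟨fun _ => ?_, fun i j hij => absurd rfl hij, fun _ =>
    disjoint_charGraph_addrs_edgeGraph_addrs _ _ _ _ _, fun i j hij => absurd rfl hij⟩
  rw [charGraph_src]
  refine Set.Subset.antisymm (fun x hx => ?_) fun x hx => ⟨?_, Or.inl ?_⟩
  · exact (charGraph_verts_subset hT.2.2.2.2 h.length hx.1).resolve_right fun hb =>
      Set.disjoint_left.1 (disjoint_below_edgeGraph_verts hT h) hb hx.2
  · exact mem_charGraph_verts_of_mem_args hT.2.2.2.2 h.length hx
  · exact mem_bodyGraph_verts_of_mem_args (h.length.trans hT.2.1.symm) hx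

theorem wf_charGraph (heq : Δ.EqualityFree) (hT : WellTyped T n) (h : FreshArgs args p n) :
    (charGraph T args p).WF ar := by
  induction T generalizing args p n with
  | leaf => exact PreGraph.wf_discrete h.nodup
  | edge ρ k sub rest ihs ihr =>
    obtain rfl : arP ρ.1.head = n := hT.2.1
    refine (gluable_edgeGraph hT h).wf ((gluable_bodyGraph hT h).wf (wf_bodyGraph h) fun i => ?_)
      fun _ => ihr hT.2.2.2.2 (h.cons 0)
    obtain ⟨c, hc, hsub⟩ := hT.exists_call i
    exact ihs i hsub (h.callArgs (heq ρ.1 ρ.2) hc)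

end Vertices

section Occurrences

theorem bodyGraph_verts_subset_attVerts_union {ρ : SIDRule ar arP} (hρ : ρ.RegularBody)
    (args : List TVar) (p : List ℕ) : (bodyGraph ρ args p).verts ⊆
      PreEdge.attVerts (bodyGraph ρ args p).edges ∪
        ⋃ i : Fin ρ.calls.length, {x | x ∈ callArgs ρ args p i} := by
  rintro _ ⟨z, rfl⟩
  rcases hρ.occurs z with ⟨a, ha, hrel, hz⟩ | ⟨c, hc, t, rfl⟩
  · obtain ⟨e, he, hatt⟩ := QFormula.exists_mem_relEdges (inst args p) (Prod.mk p) ha hrel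
    exact Or.inl ⟨e, he, hatt z hz⟩
  · obtain ⟨i, hi⟩ := List.mem_iff_getElem?.1 hc
    refine Or.inr (Set.mem_iUnion.2 ⟨⟨i, (List.getElem?_eq_some_iff.1 hi).1⟩, ?_⟩)
    rw [callArgs_eq_ofFn hi]
    exact List.mem_ofFn.2 ⟨t, rfl⟩

theorem charGraph_verts_subset_attVerts (hreg : ∀ ρ ∈ Δ.rules, ¬ ρ.Unproductive → ρ.RegularBody)
    {T : PTree Δ.rules} (hleaf : T ≠ .leaf) {n : ℕ} (hT : WellTyped T n) {args : List TVar}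
    {p : List ℕ} (h : args.length = n) :
    (charGraph T args p).verts ⊆ PreEdge.attVerts (charGraph T args p).edges := by
  induction T generalizing args p n with
  | leaf => exact absurd rfl hleaf
  | edge ρ k sub rest ihs ihr =>
    obtain ⟨hprod, rfl, rfl, hsub_ne, hrest⟩ := id hT
    simp only [charGraph, PreGraph.glue, PreEdge.attVerts_union, PreEdge.attVerts_iUnion,
      Set.iUnion_const]
    have hsub : ∀ i : Fin ρ.1.calls.length,
        (charGraph (sub i) (callArgs ρ.1 args p i) (((i : ℕ) + 1) :: p)).verts ⊆
          PreEdge.attVerts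
            (charGraph (sub i) (callArgs ρ.1 args p i) (((i : ℕ) + 1) :: p)).edges := fun i => by
      obtain ⟨c, hc, hi⟩ := hT.exists_call i
      exact ihs i (hsub_ne i).1 hi (length_callArgs hc args p)
    have hbody := (bodyGraph_verts_subset_attVerts_union (hreg ρ.1 ρ.2 hprod) args p).trans
      (Set.union_subset_union_right _ (Set.iUnion_mono fun i x hx => by
        obtain ⟨c, hc, hi⟩ := hT.exists_call i
        exact hsub i (mem_charGraph_verts_of_mem_args hi (length_callArgs hc args p) hx)))
    refine Set.union_subset (Set.union_subset (hbody.trans Set.subset_union_left)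
      ((Set.iUnion_mono hsub).trans (Set.subset_union_right.trans Set.subset_union_left))) ?_
    by_cases hrest_leaf : rest = .leaf
    · subst hrest_leaf
      exact fun x hx => Or.inl (hbody (mem_bodyGraph_verts_of_mem_args h hx))
    · exact (ihr hrest_leaf hrest h).trans Set.subset_union_right

theorem mem_atoms_charFormAux_edge {ρ : Δ.rules} {k : ℕ} {sub : Fin k → PTree Δ.rules}
    {rest : PTree Δ.rules} {args : List TVar} {p : List ℕ} {a : Atom ar TVar} :
    a ∈ (charFormAux (.edge ρ k sub rest) args p).atoms ↔
      (∃ b ∈ ρ.1.psi.atoms, b.subst (inst args p) = a) ∨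
      (∃ i : Fin k,
        a ∈ (charFormAux (sub i) (callArgs ρ.1 args p i) (((i : ℕ) + 1) :: p)).atoms) ∨
      a ∈ (charFormAux rest args (0 :: p)).atoms := by
  simp only [charFormAux, QFormula.atoms, List.mem_append, QFormula.mem_atoms_bigStar,
    List.mem_ofFn, exists_exists_eq_and, QFormula.atoms_subst, List.mem_map, callArgs]

theorem eq_notMem_atoms_charFormAux (heq : Δ.EqualityFree) (T : PTree Δ.rules) (args : List TVar)
    (p : List ℕ) (x y : TVar) : Atom.eq x y ∉ (charFormAux T args p).atoms := by
  induction T generalizing args p with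
  | leaf => exact List.not_mem_nil
  | edge ρ k sub rest ihs ihr =>
    rw [mem_atoms_charFormAux_edge]
    rintro (⟨b, hb, hbxy⟩ | ⟨i, hi⟩ | hrest)
    · cases b with
      | eq x' y' => exact (heq ρ.1 ρ.2).1 x' y' hb
      | neq x' y' => cases hbxy
      | rel r xs => cases hbxy
    · exact ihs i _ _ hi
    · exact ihr _ _ hrest

theorem vars_subset_charGraph_verts {T : PTree Δ.rules} {args : List TVar} {p : List ℕ}
    {a : Atom ar TVar} (ha : a ∈ (charFormAux T args p).atoms) :
    a.vars ⊆ (charGraph T args p).verts := by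
  induction T generalizing args p with
  | leaf => exact absurd ha List.not_mem_nil
  | edge ρ k sub rest ihs ihr =>
    rcases mem_atoms_charFormAux_edge.1 ha with ⟨b, -, rfl⟩ | ⟨i, hi⟩ | hrest
    · rw [Atom.vars_subst]
      exact (Set.image_subset_range _ _).trans
        (Set.subset_union_left.trans Set.subset_union_left)
    · exact fun x hx => Or.inl (Or.inr (Set.mem_iUnion.2 ⟨i, ihs i hi hx⟩))
    · exact fun x hx => Or.inr (Set.mem_iUnion.2 ⟨(), ihr hrest hx⟩)

end Occurrences

end SID

namespace PTree

variable {R S : Type*}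

theorem map_join (f : R → S) (t t' : PTree R) : (t.join t').map f = (t.map f).join (t'.map f) := by
  induction t with
  | leaf => rfl
  | edge ρ k sub rest _ ih => simp only [join, map, ih]

theorem map_foldr_join (f : R → S) (l : List (PTree R)) :
    (l.foldr join leaf).map f = (l.map (map f)).foldr join leaf := by
  induction l with
  | nil => rfl
  | cons t l ih => simp only [List.foldr_cons, List.map_cons, map_join, ih]

theorem map_map {S' : Type*} (f : R → S) (g : S → S') (t : PTree R) :
    (t.map f).map g = t.map (g ∘ f) := by
  induction t with
  | leaf => rfl
  | edge ρ k sub rest ihs ih => simp only [map, ih, ihs, Function.comp]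

theorem map_id (t : PTree R) : t.map id = t := by
  induction t with
  | leaf => rfl
  | edge ρ k sub rest ihs ih => simp only [map, ih, ihs, id]

theorem Iso.map {t t' : PTree R} (f : R → S) (h : t.Iso t') : (t.map f).Iso (t'.map f) := by
  induction h with
  | leaf => exact .leaf
  | edge ρ k sub sub' rest rest' _ _ ihs ih => exact .edge _ _ _ _ _ _ ihs ih
  | swap => exact .swap ..
  | trans _ _ _ _ _ ih ih' => exact .trans _ _ _ ih ih'

theorem Iso.ne_leaf {t t' : PTree R} (h : t.Iso t') (ht : t ≠ PTree.leaf) :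
    t' ≠ PTree.leaf := by
  induction h with
  | leaf => exact ht
  | edge => exact nofun
  | swap => exact nofun
  | trans _ _ _ _ _ ih ih' => exact ih' (ih ht)

theorem join_ne_leaf {t : PTree R} (ht : t ≠ leaf) (t' : PTree R) : t.join t' ≠ leaf := by
  cases t with
  | leaf => exact (ht rfl).elim
  | edge => exact nofun

theorem foldr_join_ne_leaf {l : List (PTree R)} (hl : l ≠ []) (h : ∀ t ∈ l, t ≠ leaf) :
    l.foldr join leaf ≠ leaf := by
  obtain ⟨t, l, rfl⟩ := List.exists_cons_of_ne_nil hl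
  exact join_ne_leaf (h t List.mem_cons_self) _

end PTree

namespace DTree

variable {R S N : Type*}

/-- Relabelling of the edges. -/
def map (f : R → S) : DTree R → DTree S
  | node ρ k sub => node (f ρ) k fun i => (sub i).map f

theorem Derives.map {f : R → S} {lhs : S → N} {rhs : S → List N} {U : DTree R} {a : N}
    (h : U.Derives (lhs ∘ f) (rhs ∘ f) a) : (U.map f).Derives lhs rhs a := by
  induction U generalizing a with
  | node ρ k sub ih =>
    obtain ⟨hlhs, hk, hsub⟩ := h
    exact ⟨hlhs, hk, fun i => ih i (hsub i)⟩

theorem contract_map (f : R → S) (unprod : S → Prop) (U : DTree R) :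
    (U.map f).contract unprod = (U.contract (unprod ∘ f)).map f := by
  induction U with
  | node ρ k sub ih =>
    simp only [map, contract, Function.comp_apply, ih]
    split_ifs
    · rw [PTree.map_foldr_join, List.map_ofFn]
      rfl
    · rfl

end DTree

section ParseTrees

variable {R S N : Type*} {lhs : S → N} {rhs : S → List N} {unprod : S → Prop} {a : N}

theorem map_mem_parseTrees (f : R → S) {T : PTree R}
    (hT : T ∈ parseTrees (lhs ∘ f) (rhs ∘ f) (unprod ∘ f) a) :
    T.map f ∈ parseTrees lhs rhs unprod a := by
  obtain ⟨U, hU, hiso⟩ := hT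
  exact ⟨U.map f, hU.map, DTree.contract_map f unprod U ▸ hiso.map f⟩

theorem map_mem_parseTrees_iff (γ : R ≃ S) (T : PTree R) :
    T.map γ ∈ parseTrees lhs rhs unprod a ↔
      T ∈ parseTrees (lhs ∘ γ) (rhs ∘ γ) (unprod ∘ γ) a := by
  refine ⟨fun h => ?_, map_mem_parseTrees γ⟩
  have h' : T.map γ ∈ parseTrees ((lhs ∘ γ) ∘ γ.symm) ((rhs ∘ γ) ∘ γ.symm)
      ((unprod ∘ γ) ∘ γ.symm) a := by
    simpa only [Function.comp_assoc, Equiv.self_comp_symm, Function.comp_id] using h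
  simpa only [PTree.map_map, Equiv.symm_comp_self, PTree.map_id] using
    map_mem_parseTrees γ.symm h'

end ParseTrees

theorem SIDRule.PassesParams.arity {L : Type u} {ar : L → ℕ} {P : Type v} {arP : P → ℕ}
    {ρ : SIDRule ar arP} {c : PredAtom arP (Fin (arP ρ.head) ⊕ Fin ρ.m)} (h : ρ.PassesParams c) :
    arP c.pred = arP ρ.head := by
  simpa only [List.length_ofFn] using congrArg List.length h

namespace SID

variable {L : Type u} {ar : L → ℕ} {P : Type v} {arP : P → ℕ} {Δ : SID ar arP}

theorem WellTyped.join {t t' : PTree Δ.rules} {n : ℕ} (h : WellTyped t n) (h' : WellTyped t' n) :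
    WellTyped (t.join t') n := by
  induction t with
  | leaf => exact h'
  | edge ρ k sub rest _ ih =>
    obtain ⟨hprod, hhead, hk, hsub, hrest⟩ := h
    exact ⟨hprod, hhead, hk, hsub, ih hrest⟩

theorem WellTyped.foldr_join {l : List (PTree Δ.rules)} {n : ℕ} (h : ∀ t ∈ l, WellTyped t n) :
    WellTyped (l.foldr PTree.join PTree.leaf) n := by
  induction l with
  | nil => trivial
  | cons t l ih => exact (h t (by simp)).join (ih fun t' ht' => h t' (by simp [ht']))

theorem WellTyped.iso {t t' : PTree Δ.rules} (hiso : t.Iso t') {n : ℕ} (h : WellTyped t n) :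
    WellTyped t' n := by
  induction hiso generalizing n with
  | leaf => trivial
  | edge ρ k sub sub' rest rest' hs _ ihs ih =>
    obtain ⟨hprod, hhead, hk, hsub, hrest⟩ := h
    exact ⟨hprod, hhead, hk,
      fun i => ⟨(hs i).ne_leaf (hsub i).1, fun c hc => ihs i ((hsub i).2 c hc)⟩, ih hrest⟩
  | swap =>
    obtain ⟨hprod, hhead, hk, hsub, hprod', hhead', hk', hsub', hrest⟩ := h
    exact ⟨hprod', hhead', hk', hsub', hprod, hhead, hk, hsub, hrest⟩
  | trans _ _ _ _ _ ih ih' => exact ih' (ih h)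

theorem wellTyped_contract (hun : ∀ ρ ∈ Δ.rules, ρ.Unproductive → ρ.calls ≠ [])
    (U : DTree Δ.rules) {a : P}
    (hU : U.Derives (fun ρ : Δ.rules => ρ.1.head)
      (fun ρ : Δ.rules => ρ.1.calls.map PredAtom.pred) a) :
    WellTyped (U.contract fun ρ : Δ.rules => ρ.1.Unproductive) (arP a) ∧
      (U.contract fun ρ : Δ.rules => ρ.1.Unproductive) ≠ PTree.leaf := by
  induction U generalizing a with
  | node ρ k sub ih =>
    obtain ⟨rfl, hk, hsub⟩ := hU
    obtain rfl : ρ.1.calls.length = k := by simpa only [List.length_map] using hk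
    have hs : ∀ i : Fin ρ.1.calls.length, _ ∧ _ := fun i => ih i (hsub i)
    simp only [List.get_eq_getElem, Fin.val_cast, List.getElem_map] at hs
    rw [DTree.contract]
    split_ifs with hρ
    · constructor
      · refine WellTyped.foldr_join fun t ht => ?_
        obtain ⟨i, rfl⟩ := List.mem_ofFn.1 ht
        rw [← (hρ.2.2 _ (List.getElem_mem i.2)).arity]
        exact (hs i).1
      · have hcalls : ρ.1.calls.length ≠ 0 := mt List.length_eq_zero_iff.1 (hun ρ.1 ρ.2 hρ)
        refine PTree.foldr_join_ne_leaf (mt List.ofFn_eq_nil_iff.1 hcalls) fun t ht => ?_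
        obtain ⟨i, rfl⟩ := List.mem_ofFn.1 ht
        exact (hs i).2
    · refine ⟨⟨hρ, rfl, rfl, fun i => ⟨(hs i).2, fun c hc => ?_⟩, trivial⟩, nofun⟩
      obtain ⟨hi, rfl⟩ := List.getElem?_eq_some_iff.1 hc
      exact (hs i).1

theorem wellTyped_of_mem_parseTrees (hun : ∀ ρ ∈ Δ.rules, ρ.Unproductive → ρ.calls ≠ [])
    {A : P} {T : PTree Δ.rules} (hT : T ∈ Δ.parseTrees A) :
    WellTyped T (arP A) ∧ T ≠ PTree.leaf := by
  obtain ⟨U, hU, hiso⟩ := hT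
  obtain ⟨htyped, hleaf⟩ := wellTyped_contract hun U hU
  exact ⟨htyped.iso hiso, hiso.ne_leaf hleaf⟩

end SID

/-! ## The grammar of a SID -/

theorem InternalPath.map {V W : Type*} {adj : V → V → Prop} {internal : V → Prop}
    {adj' : W → W → Prop} {internal' : W → Prop} {a b : V} (f : V → W)
    (hadj : ∀ a b, adj a b → adj' (f a) (f b)) (hint : ∀ a, internal a → internal' (f a))
    (h : InternalPath adj internal a b) : InternalPath adj' internal' (f a) (f b) := by
  induction h with
  | single a b h => exact .single _ _ (hadj a b h)
  | cons a c b h hc _ ih => exact .cons _ _ _ (hadj a c h) (hint c hc) ih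

/-- The vertex that represents a variable of a rule. -/
def ruleVarName {n m : ℕ} : Fin n ⊕ Fin m → ℕ
  | .inl i => 2 * i
  | .inr j => 2 * j + 1

theorem ruleVarName_injective {n m : ℕ} :
    Function.Injective (ruleVarName : Fin n ⊕ Fin m → ℕ) := by
  rintro (i | i) (j | j) h <;> simp only [ruleVarName] at h
  · rw [Fin.ext (by omega : (i : ℕ) = j)]
  · omega
  · omega
  · rw [Fin.ext (by omega : (i : ℕ) = j)]

namespace SIDRule

variable {L : Type u} {ar : L → ℕ} {P : Type v} {arP : P → ℕ}

/-- The relation atoms of a rule as edges. Their identities are even, so as to differ from those of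
the predicate atoms, and record the number `d` of the rule. -/
def atomEdges (ρ : SIDRule ar arP) (d : ℕ) : Set (PreEdge L ℕ) :=
  ρ.psi.relEdges ruleVarName fun i => Nat.pair d (2 * i)

/-- The predicate atoms of a rule as nonterminal edges, with odd identities. -/
def callList (ρ : SIDRule ar arP) (d : ℕ) : List (HEdge P) :=
  ρ.calls.mapIdx fun i c =>
    ⟨Nat.pair d (2 * i + 1), c.pred, List.ofFn fun t => ruleVarName (c.args t)⟩

variable {ρ : SIDRule ar arP} {d : ℕ}

theorem pair_two_mul_injective (d : ℕ) : Function.Injective fun i => Nat.pair d (2 * i) :=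
  fun i j h => by
    have hij := (Nat.pair_eq_pair.1 h).2
    omega

theorem exists_addr_eq_of_mem_atomEdges {e : PreEdge L ℕ} (he : e ∈ ρ.atomEdges d) :
    ∃ i, e.addr = Nat.pair d (2 * i) := by
  obtain ⟨i, -, hi⟩ :=
    QFormula.addr_image_relEdges_subset _ _ _ (Set.mem_image_of_mem PreEdge.addr he)
  exact ⟨i, hi.symm⟩

theorem mem_callList {e : HEdge P} :
    e ∈ ρ.callList d ↔ ∃ i c, ρ.calls[i]? = some c ∧
      e = ⟨Nat.pair d (2 * i + 1), c.pred, List.ofFn fun t => ruleVarName (c.args t)⟩ := by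
  rw [callList, List.mem_iff_getElem?]
  simp only [List.getElem?_mapIdx, Option.map_eq_some_iff, eq_comm (b := e)]

theorem length_callList (ρ : SIDRule ar arP) (d : ℕ) :
    (ρ.callList d).length = ρ.calls.length :=
  List.length_mapIdx

theorem getElem_callList {i : ℕ} (hi : i < ρ.calls.length) :
    (ρ.callList d)[i]'((length_callList ρ d).symm ▸ hi) = ⟨Nat.pair d (2 * i + 1),
      ρ.calls[i].pred, List.ofFn fun t => ruleVarName (ρ.calls[i].args t)⟩ :=
  List.getElem_mapIdx

theorem eq_of_mem_callList {e e' : HEdge P} (he : e ∈ ρ.callList d) (he' : e' ∈ ρ.callList d)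
    (hid : e.id = e'.id) : e = e' := by
  obtain ⟨i, c, hc, rfl⟩ := mem_callList.1 he
  obtain ⟨j, c', hc', rfl⟩ := mem_callList.1 he'
  have hij := (Nat.pair_eq_pair.1 hid).2
  obtain rfl : i = j := by omega
  rw [hc] at hc'
  cases hc'
  rfl

theorem id_ne_addr_of_mem {e : HEdge P} {e' : PreEdge L ℕ} (he : e ∈ ρ.callList d)
    (he' : e' ∈ ρ.atomEdges d) : e.id ≠ e'.addr := by
  obtain ⟨i, c, -, rfl⟩ := mem_callList.1 he
  obtain ⟨j, hj⟩ := exists_addr_eq_of_mem_atomEdges he'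
  rw [hj]
  intro h
  have hij := (Nat.pair_eq_pair.1 h).2
  omega

/-- The graph of a rule: its vertices are the variables, its edges the relation and predicate atoms,
and its sources the parameters. -/
def ruleGraph (ρ : SIDRule ar arP) (d : ℕ) : CGraph (Sum.elim ar arP) where
  verts := Set.range (ruleVarName : Fin (arP ρ.head) ⊕ Fin ρ.m → ℕ)
  edges := (fun e => ⟨e.addr, .inl e.lab, e.att⟩) '' ρ.atomEdges d ∪
    (fun e => ⟨e.id, .inr e.lab, e.att⟩) '' {e | e ∈ ρ.callList d}
  src := List.ofFn fun i : Fin (arP ρ.head) => ruleVarName (m := ρ.m) (.inl i)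
  verts_finite := Set.finite_range _
  edges_finite := ((QFormula.relEdges_finite _ _ (pair_two_mul_injective d)).image _).union
    ((List.finite_toSet _).image _)
  id_inj := by
    rintro _ (⟨e, he, rfl⟩ | ⟨e, he, rfl⟩) _ (⟨e', he', rfl⟩ | ⟨e', he', rfl⟩) hid
    · rw [QFormula.addr_injOn_relEdges _ _ (pair_two_mul_injective d) he he' hid]
    · exact (id_ne_addr_of_mem he' he hid.symm).elim
    · exact (id_ne_addr_of_mem he he' hid).elim
    · rw [eq_of_mem_callList he he' hid]
  att_length := by
    rintro _ (⟨e, he, rfl⟩ | ⟨e, he, rfl⟩)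
    · exact QFormula.att_length_of_mem_relEdges he
    · obtain ⟨i, c, -, rfl⟩ := mem_callList.1 he
      exact List.length_ofFn
  att_mem := by
    rintro _ (⟨e, he, rfl⟩ | ⟨e, he, rfl⟩) x hx
    · exact QFormula.mem_range_of_mem_att_relEdges he hx
    · obtain ⟨i, c, -, rfl⟩ := mem_callList.1 he
      obtain ⟨t, rfl⟩ := List.mem_ofFn.1 hx
      exact ⟨c.args t, rfl⟩
  src_mem := by
    intro x hx
    obtain ⟨i, rfl⟩ := List.mem_ofFn.1 hx
    exact ⟨.inl i, rfl⟩
  src_nodup := List.nodup_ofFn.2 (ruleVarName_injective.comp Sum.inl_injective)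

theorem ruleVarName_mem_src (d : ℕ) (z : Fin (arP ρ.head) ⊕ Fin ρ.m) :
    ruleVarName z ∈ (ρ.ruleGraph d).src ↔ z.isLeft = true := by
  constructor
  · intro h
    obtain ⟨i, hi⟩ := List.mem_ofFn.1 h
    rw [← ruleVarName_injective hi]
    rfl
  · rcases z with i | j
    · exact fun _ => List.mem_ofFn.2 ⟨i, rfl⟩
    · simp

theorem termEdges_ruleGraph (ρ : SIDRule ar arP) (d : ℕ) :
    HRRhs.termEdges (ρ.ruleGraph d) = PreEdge.real id id '' ρ.atomEdges d := by
  ext ⟨k, r, a⟩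
  simp [HRRhs.termEdges, ruleGraph, PreEdge.real]

theorem mem_edges_ruleGraph_inr {e : HEdge P} :
    (⟨e.id, .inr e.lab, e.att⟩ : HEdge (L ⊕ P)) ∈ (ρ.ruleGraph d).edges ↔
      e ∈ ρ.callList d := by
  obtain ⟨k, B, a⟩ := e
  simp only [ruleGraph, Set.mem_union, Set.mem_image, Set.mem_ofPred_eq, HEdge.mk.injEq,
    reduceCtorEq, Sum.inr.injEq, false_and, and_false, exists_false, false_or]
  constructor
  · rintro ⟨e, he, rfl, rfl, rfl⟩
    exact he
  · exact fun he => ⟨_, he, rfl, rfl, rfl⟩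

theorem mem_edges_ruleGraph_cases {e : HEdge (L ⊕ P)} (he : e ∈ (ρ.ruleGraph d).edges) :
    (∃ a ∈ ρ.psi.atoms, a.isRel = true ∧ ∀ z ∈ a.vars, ruleVarName z ∈ e.att) ∨
      ∃ c ∈ ρ.calls, ∀ z ∈ Set.range c.args, ruleVarName z ∈ e.att := by
  obtain ⟨e, he, rfl⟩ | ⟨e, he, rfl⟩ := he
  · exact Or.inl (QFormula.exists_atom_of_mem_relEdges he)
  · obtain ⟨i, c, hc, rfl⟩ := mem_callList.1 he
    refine Or.inr ⟨c, List.mem_of_getElem? hc, ?_⟩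
    rintro _ ⟨t, rfl⟩
    exact List.mem_ofFn.2 ⟨t, rfl⟩

theorem wellFormed_ruleGraph (heq : ρ.EqualityFree) (d : ℕ) :
    (HRRhs.op (ρ.ruleGraph d) (ρ.callList d)).WellFormed (arP ρ.head) := by
  refine ⟨List.length_ofFn, ?_, ?_, fun e => mem_edges_ruleGraph_inr.symm⟩
  · refine List.nodup_iff_injective_getElem.2 fun i j hij => ?_
    have hlen := length_callList ρ d
    have hget : (ρ.callList d)[(i : ℕ)] = (ρ.callList d)[(j : ℕ)] := hij
    rw [getElem_callList (i.2.trans_eq hlen), getElem_callList (j.2.trans_eq hlen)] at hget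
    have hid := (Nat.pair_eq_pair.1 (HEdge.mk.inj hget).1).2
    exact Fin.ext (by omega)
  · intro e he
    obtain ⟨i, c, hc, rfl⟩ := mem_callList.1 he
    exact List.nodup_ofFn.2 (ruleVarName_injective.comp (heq.2 c (List.mem_of_getElem? hc)))

theorem RegularBody.exists_rel_or_calls_ne_nil (hρ : ρ.RegularBody) :
    (∃ a ∈ ρ.psi.atoms, a.isRel = true) ∨ ρ.calls ≠ [] := by
  obtain ⟨⟨-, -, a, ha, -⟩ | ⟨h, -⟩, -⟩ := hρ
  · exact Or.inl ⟨a, List.mem_filter.1 (ha ▸ List.mem_singleton_self a)⟩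
  · exact h

theorem RegularBody.not_unproductive (hρ : ρ.RegularBody) : ¬ρ.Unproductive := by
  rintro ⟨hm, hψ, -⟩
  have hatoms : ¬∃ a ∈ ρ.psi.atoms, a.isRel = true := by simp [hψ, QFormula.atoms]
  have hcalls : ρ.calls ≠ [] := hρ.exists_rel_or_calls_ne_nil.resolve_left hatoms
  obtain ⟨c, hc⟩ := List.exists_mem_of_ne_nil _ hcalls
  obtain ⟨⟨-, hnil, -⟩ | ⟨-, -, hinternal⟩, -⟩ := hρ
  · exact hcalls hnil
  · obtain ⟨j, -⟩ := hinternal c hc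
    exact Fin.elim0 (hm ▸ j)

theorem RegularBody.edges_ruleGraph_nonempty (hρ : ρ.RegularBody) (d : ℕ) :
    (ρ.ruleGraph d).edges.Nonempty := by
  obtain ⟨a, ha, hrel⟩ | hcalls := hρ.exists_rel_or_calls_ne_nil
  · obtain ⟨e, he, -⟩ := QFormula.exists_mem_relEdges _ _ ha hrel
    exact ⟨_, Or.inl ⟨e, he, rfl⟩⟩
  · obtain ⟨e, he⟩ : ∃ e, e ∈ ρ.callList d := by
      refine List.exists_mem_of_ne_nil _ fun h => hcalls ?_
      rwa [← List.length_eq_zero_iff, length_callList, List.length_eq_zero_iff] at h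
    exact ⟨_, Or.inr ⟨e, he, rfl⟩⟩

theorem exists_edges_ruleGraph_eq_singleton (hm : ρ.m = 0) (hcalls : ρ.calls = [])
    {a : Atom ar (Fin (arP ρ.head) ⊕ Fin ρ.m)} (ha : ρ.psi.atoms.filter Atom.isRel = [a])
    (hall : ∀ z, z ∈ a.vars) (d : ℕ) :
    ∃ e : HEdge L, (ρ.ruleGraph d).edges = {⟨e.id, .inl e.lab, e.att⟩} ∧
      (ρ.ruleGraph d).verts = {x | x ∈ (ρ.ruleGraph d).src} ∧
      ∀ x ∈ (ρ.ruleGraph d).src, x ∈ e.att := by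
  obtain ⟨e, he, hatt⟩ := QFormula.exists_relEdges_eq_singleton (X := ℕ) ruleVarName
    (fun i => Nat.pair d (2 * i)) ha
  refine ⟨⟨e.addr, e.lab, e.att⟩, ?_, ?_, ?_⟩
  · have hcallList : {e | e ∈ ρ.callList d} = ∅ := by simp [callList, hcalls]
    simp only [ruleGraph, atomEdges, he, hcallList, Set.image_singleton, Set.image_empty,
      Set.union_empty]
  · refine Set.Subset.antisymm ?_ (ρ.ruleGraph d).src_mem
    rintro _ ⟨i | j, rfl⟩
    · exact (ruleVarName_mem_src d _).2 rfl
    · exact Fin.elim0 (hm ▸ j)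
  · intro x hx
    obtain ⟨z, rfl⟩ := (ρ.ruleGraph d).src_mem x hx
    exact hatt z (hall z)

theorem RegularBody.regularOp_ruleGraph (hρ : ρ.RegularBody) (d : ℕ) :
    HRRhs.RegularOp (ρ.ruleGraph d) := by
  have hne := hρ.edges_ruleGraph_nonempty d
  have hinternal : ∀ z : Fin (arP ρ.head) ⊕ Fin ρ.m, z.isRight = true →
      ruleVarName z ∉ (ρ.ruleGraph d).src := fun z hz h =>
    Sum.not_isLeft.2 hz ((ruleVarName_mem_src d z).1 h)
  obtain ⟨hbody, hpath⟩ := hρ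
  constructor
  · rcases hbody with ⟨hm, hcalls, a, ha, hall⟩ | ⟨-, hrel, hcall⟩
    · exact Or.inl (exists_edges_ruleGraph_eq_singleton hm hcalls ha hall d)
    · refine Or.inr ⟨hne, fun e he => ?_⟩
      rcases mem_edges_ruleGraph_cases he with ⟨a, ha, hr, hatt⟩ | ⟨c, hc, hatt⟩
      · obtain ⟨j, hj⟩ := hrel a ha hr
        exact ⟨_, hatt _ hj, hinternal _ rfl⟩
      · obtain ⟨j, hj⟩ := hcall c hc
        exact ⟨_, hatt _ hj, hinternal _ rfl⟩
  · rintro _ ⟨z, rfl⟩ _ ⟨z', rfl⟩ hzz'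
    refine (hpath z z' fun h => hzz' (h ▸ rfl)).map ruleVarName ?_ hinternal
    rintro z z' ⟨a, ha, hr, hz, hz'⟩
    obtain ⟨e, he, hatt⟩ := QFormula.exists_mem_relEdges _ _ ha hr
    exact ⟨⟨e.addr, e.lab, e.att⟩, Or.inl ⟨e, he, rfl⟩, hatt z hz, hatt z' hz'⟩

open Classical in
/-- The grammar rule of a SID rule; the number `d` keeps the grammar rules of distinct productive
SID rules distinct. -/
noncomputable def toHR (ρ : SIDRule ar arP) (d : ℕ) : P × HRRhs ar arP :=
  (ρ.head, if ρ.Unproductive then .par (ρ.calls.map PredAtom.pred)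
    else .op (ρ.ruleGraph d) (ρ.callList d))

theorem toHR_of_unproductive (h : ρ.Unproductive) (d : ℕ) :
    (ρ.toHR d).2 = .par (ρ.calls.map PredAtom.pred) :=
  if_pos h

theorem toHR_of_not_unproductive (h : ¬ρ.Unproductive) (d : ℕ) :
    (ρ.toHR d).2 = .op (ρ.ruleGraph d) (ρ.callList d) :=
  if_neg h

theorem nonterms_toHR (ρ : SIDRule ar arP) (d : ℕ) :
    (ρ.toHR d).2.nonterms = ρ.calls.map PredAtom.pred := by
  by_cases h : ρ.Unproductive
  · rw [toHR_of_unproductive h]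
    rfl
  · rw [toHR_of_not_unproductive h]
    exact List.ext_getElem (by simp [HRRhs.nonterms, callList])
      fun i h₁ h₂ => by simp [HRRhs.nonterms, callList]

theorem isPar_toHR (ρ : SIDRule ar arP) (d : ℕ) : (ρ.toHR d).2.IsPar ↔ ρ.Unproductive := by
  by_cases h : ρ.Unproductive
  · simp [toHR_of_unproductive h, h, HRRhs.IsPar]
  · simp [toHR_of_not_unproductive h, h, HRRhs.IsPar]

theorem wellFormed_toHR (heq : ρ.EqualityFree) (d : ℕ) :
    (ρ.toHR d).2.WellFormed (arP ρ.head) := by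
  by_cases h : ρ.Unproductive
  · rw [toHR_of_unproductive h]
    intro a ha
    obtain ⟨c, hc, rfl⟩ := List.mem_map.1 ha
    exact (h.2.2 c hc).arity
  · rw [toHR_of_not_unproductive h]
    exact wellFormed_ruleGraph heq d

theorem eq_of_passesParams {c c' : PredAtom arP (Fin (arP ρ.head) ⊕ Fin ρ.m)}
    (hpred : c.pred = c'.pred) (hc : ρ.PassesParams c) (hc' : ρ.PassesParams c') : c = c' := by
  obtain ⟨B, args⟩ := c
  obtain ⟨B', args'⟩ := c'
  obtain rfl : B = B' := hpred
  congr 1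
  exact List.ofFn_injective (hc.trans hc'.symm)

theorem Unproductive.eq {ρ' : SIDRule ar arP} (h : ρ.Unproductive) (h' : ρ'.Unproductive)
    (hhead : ρ.head = ρ'.head)
    (hcalls : ρ.calls.map PredAtom.pred = ρ'.calls.map PredAtom.pred) : ρ = ρ' := by
  obtain ⟨B, m, ψ, calls⟩ := ρ
  obtain ⟨B', m', ψ', calls'⟩ := ρ'
  obtain ⟨hm, hψ, hpass⟩ := h
  obtain ⟨hm', hψ', hpass'⟩ := h'
  obtain rfl : m = 0 := hm
  obtain rfl : m' = 0 := hm'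
  obtain rfl : ψ = .emp := hψ
  obtain rfl : ψ' = .emp := hψ'
  obtain rfl : B = B' := hhead
  congr 1
  refine List.ext_getElem (by simpa using congrArg List.length hcalls) fun i hi hi' => ?_
  have hpred : calls[i].pred = calls'[i].pred := by
    rw [← List.getElem_map PredAtom.pred (h := by simpa using hi), List.getElem_of_eq hcalls,
      List.getElem_map]
  exact eq_of_passesParams hpred (hpass _ (List.getElem_mem hi)) (hpass' _ (List.getElem_mem hi'))

theorem unpair_id_of_mem_edges_ruleGraph {e : HEdge (L ⊕ P)}
    (he : e ∈ (ρ.ruleGraph d).edges) : (Nat.unpair e.id).1 = d := by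
  obtain ⟨e, he, rfl⟩ | ⟨e, he, rfl⟩ := he
  · obtain ⟨i, hi⟩ := exists_addr_eq_of_mem_atomEdges he
    simp [hi]
  · obtain ⟨i, c, -, rfl⟩ := mem_callList.1 he
    simp

theorem RegularBody.index_eq_of_toHR_eq {ρ' : SIDRule ar arP} {d' : ℕ} (hρ : ρ.RegularBody)
    (h : ρ.toHR d = ρ'.toHR d') : d = d' := by
  have hun' : ¬ρ'.Unproductive := by
    rw [← isPar_toHR ρ' d', ← h, isPar_toHR]
    exact hρ.not_unproductive
  have hrhs := congrArg Prod.snd h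
  rw [toHR_of_not_unproductive hρ.not_unproductive, toHR_of_not_unproductive hun'] at hrhs
  obtain ⟨e, he⟩ := hρ.edges_ruleGraph_nonempty d
  have he' : e ∈ (ρ'.ruleGraph d').edges := (HRRhs.op.inj hrhs).1 ▸ he
  exact (unpair_id_of_mem_edges_ruleGraph he).symm.trans (unpair_id_of_mem_edges_ruleGraph he')

end SIDRule

namespace SID

variable {L : Type u} {ar : L → ℕ} {P : Type v} {arP : P → ℕ} {Δ : SID ar arP}

theorem Regular.regularBody (hreg : Δ.Regular) :
    ∀ ρ ∈ Δ.rules, ¬ρ.Unproductive → ρ.RegularBody := by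
  obtain ⟨Q, hQ⟩ := hreg
  intro ρ hρ hun
  rcases hQ ρ hρ with ⟨-, h, -⟩ | ⟨-, h, -⟩ | ⟨-, h⟩
  · exact (hun h).elim
  · exact (hun h).elim
  · exact h

theorem Regular.calls_ne_nil (hreg : Δ.Regular) :
    ∀ ρ ∈ Δ.rules, ρ.Unproductive → ρ.calls ≠ [] := by
  obtain ⟨Q, hQ⟩ := hreg
  intro ρ hρ hun
  rcases hQ ρ hρ with ⟨-, -, C, -, h⟩ | ⟨-, -, h, -⟩ | ⟨-, h⟩
  · intro hnil
    simp [hnil] at h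
  · exact h
  · exact (h.not_unproductive hun).elim

/-- The grammar of a SID, for a numbering `idx` of its rules. The predicate `A` is added to the
nonterminals because it need not occur in the rules. -/
noncomputable def toGrammar (Δ : SID ar arP) (heq : Δ.EqualityFree) (A : P) (idx : Δ.rules → ℕ) :
    HRGrammar ar arP where
  nonterms := insert A (⋃ ρ ∈ Δ.rules, {B | B ∈ ρ.head :: ρ.calls.map PredAtom.pred})
  rules := Set.range fun ρ : Δ.rules => ρ.1.toHR (idx ρ)
  nonterms_finite := (Δ.finite.biUnion fun _ _ => List.finite_toSet _).insert A
  rules_finite := by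
    have := Δ.finite.to_subtype
    exact Set.finite_range _
  lhs_mem := by
    rintro _ ⟨ρ, rfl⟩
    exact Or.inr (Set.mem_iUnion₂.2 ⟨ρ.1, ρ.2, List.mem_cons_self⟩)
  rhs_mem := by
    rintro _ ⟨ρ, rfl⟩ a ha
    rw [SIDRule.nonterms_toHR] at ha
    exact Or.inr (Set.mem_iUnion₂.2 ⟨ρ.1, ρ.2, List.mem_cons_of_mem _ ha⟩)
  wellFormed := by
    rintro _ ⟨ρ, rfl⟩
    exact SIDRule.wellFormed_toHR (heq ρ.1 ρ.2) _

theorem toGrammar_regular (hreg : Δ.Regular) (heq : Δ.EqualityFree) (A : P) (idx : Δ.rules → ℕ) :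
    (Δ.toGrammar heq A idx).Regular := by
  obtain ⟨Q, hQ⟩ := hreg
  refine ⟨Q ∩ (Δ.toGrammar heq A idx).nonterms, Set.inter_subset_right, ?_⟩
  intro τ hτ
  have hlhs := (Δ.toGrammar heq A idx).lhs_mem τ hτ
  have hrhs := (Δ.toGrammar heq A idx).rhs_mem τ hτ
  obtain ⟨ρ, rfl⟩ := hτ
  rw [SIDRule.nonterms_toHR] at hrhs
  rcases hQ ρ.1 ρ.2 with ⟨hB, hun, C, hC, hcalls⟩ | ⟨hB, hun, hne, hC⟩ | ⟨hB, hbody⟩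
  · refine Or.inl ⟨fun h => hB h.1, C, ⟨hC, hrhs C (by simp [hcalls])⟩, ?_⟩
    rw [SIDRule.toHR_of_unproductive hun, hcalls]
    rfl
  · refine Or.inr (Or.inl ⟨fun h => hB h.1, _, by simpa using hne, fun w hw => ⟨?_, hrhs w hw⟩,
      SIDRule.toHR_of_unproductive hun _⟩)
    obtain ⟨c, hc, rfl⟩ := List.mem_map.1 hw
    exact hC c hc
  · exact Or.inr (Or.inr ⟨⟨hB, hlhs⟩, _, _, SIDRule.toHR_of_not_unproductive
      hbody.not_unproductive _, hbody.regularOp_ruleGraph _⟩)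

theorem toHR_injective (hreg : Δ.Regular) {idx : Δ.rules → ℕ} (hidx : Function.Injective idx) :
    Function.Injective fun ρ : Δ.rules => ρ.1.toHR (idx ρ) := by
  intro ρ ρ' h
  by_cases hun : ρ.1.Unproductive
  · have hun' : ρ'.1.Unproductive := by
      rw [← SIDRule.isPar_toHR _ (idx ρ'), ← congrArg Prod.snd h]
      exact (SIDRule.isPar_toHR _ _).2 hun
    refine Subtype.ext (hun.eq hun' (congrArg Prod.fst h) ?_)
    rw [← SIDRule.nonterms_toHR _ (idx ρ), ← SIDRule.nonterms_toHR _ (idx ρ')]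
    exact congrArg (fun x => x.2.nonterms) h
  · exact hidx ((hreg.regularBody ρ.1 ρ.2 hun).index_eq_of_toHR_eq h)

end SID

/-! ## Values of parse trees -/

theorem exists_map_eq {X : Type*} {l : List X} (hl : l.Nodup) {l' : List ℕ}
    (hlen : l'.length = l.length) : ∃ s : X → ℕ, l.map s = l' := by
  classical
  refine ⟨fun x => l'.getD (l.idxOf x) 0, List.ext_getElem ?_ fun i _ hi => ?_⟩
  · rw [List.length_map, hlen]
  · rw [List.getElem_map, hl.idxOf_getElem, List.getD_eq_getElem _ _ hi]

theorem CGraph.Iso.length_src {Λ : Type u} {ar : Λ → ℕ} {G H : CGraph ar} (h : G.Iso H) :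
    H.src.length = G.src.length := by
  obtain ⟨f, -, -, -, -, -, hsrc⟩ := h
  rw [hsrc, List.length_map]

namespace PreGraph

section Copies

variable {L : Type u} {ar : L → ℕ} {X : Type v} {D : PreGraph L X} {K : CGraph ar}

theorem WF.exists_isCopy [Encodable X] (hD : D.WF ar) : ∃ K : CGraph ar, D.IsCopy K :=
  let ⟨K, hK⟩ := hD.exists_realizes Encodable.encode_injective.injOn
    Encodable.encode_injective.injOn
  ⟨K, _, _, hK⟩

theorem IsCopy.length_src (h : D.IsCopy K) : K.src.length = D.src.length := by
  obtain ⟨s, g, h⟩ := h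
  rw [h.src, List.length_map]

theorem isCopy_discrete_iff {l : List X} (hl : l.Nodup) :
    (discrete l).IsCopy K ↔ K.IsDiscrete ∧ K.src.length = l.length := by
  have image_mem (s : X → ℕ) : s '' {x | x ∈ l} = {a | a ∈ l.map s} := by
    ext a
    simp only [Set.mem_image, Set.mem_ofPred_eq, List.mem_map]
  constructor
  · intro h
    refine ⟨?_, h.length_src⟩
    obtain ⟨s, g, h⟩ := h
    refine ⟨?_, h.edges.trans (Set.image_empty _)⟩
    rw [h.verts, h.src]
    exact image_mem s
  · rintro ⟨⟨hverts, hedges⟩, hlen⟩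
    obtain ⟨s, hs⟩ := exists_map_eq hl hlen
    have s_inj := List.inj_on_of_nodup_map (hs ▸ K.src_nodup)
    refine ⟨s, fun _ => 0, fun x hx y hy h => s_inj hx hy h, ?_, ?_, ?_, hs.symm⟩
    · rw [addrs, discrete, Set.image_empty]
      exact Set.injOn_empty _
    · rw [hverts, ← hs]
      exact (image_mem s).symm
    · exact hedges.trans (Set.image_empty _).symm

end Copies

section Represents

variable {L : Type u} {ar : L → ℕ} {N : Type*} {arN : N → ℕ} {Γ : HRGrammar ar arN} {X : Type v}

/-- The values of `t` are, up to the requirement on the number of sources, the copies of `D`. The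
requirement is needed since the tree without edges has the discrete graphs of all types as its
values. -/
def Represents (D : PreGraph L X) (t : PTree Γ.rules) : Prop :=
  ∀ K : CGraph ar, HRGrammar.IsVal t K ∧ K.src.length = D.src.length ↔ D.IsCopy K

theorem represents_leaf {l : List X} (hl : l.Nodup) :
    (discrete l).Represents (.leaf : PTree Γ.rules) :=
  fun _ => (isCopy_discrete_iff hl).symm

theorem represents_edge [Encodable X] {ρ : Γ.rules} {G : CGraph (Sum.elim ar arN)}
    {es : List (HEdge N)} (hop : ρ.1.2 = .op G es) {k : ℕ} {D₀ D' : PreGraph L X}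
    {D : Fin k → PreGraph L X} {t : Fin k → PTree Γ.rules} {t' : PTree Γ.rules}
    (hglue : Gluable D₀ D) (hglue' : Gluable (D₀.glue D) fun _ : Unit => D')
    (hsrc : D'.src = D₀.src) (h₀ : D₀.WF ar) (h : ∀ i, (D i).WF ar) (h' : D'.WF ar)
    {s₀ g₀ : X → ℕ} (hG : D₀.Realizes s₀ g₀ (HRRhs.terminalPart G)) (hk : es.length = k)
    (hatt : ∀ i, (es.get (i.cast hk.symm)).att = (D i).src.map s₀)
    (ht : ∀ i, (D i).Represents (t i)) (ht' : D'.Represents t') :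
    ((D₀.glue D).glue fun _ : Unit => D').Represents (.edge ρ k t t') := by
  have isPar_iff {K K₁ K₂ : CGraph ar} (hK₁ : (D₀.glue D).IsCopy K₁) (hK₂ : D'.IsCopy K₂) :=
    isCopy_glue_iff_isPar (K := K) hglue' hsrc (hglue.wf h₀ h) h' hK₁ hK₂
  intro K
  constructor
  · rintro ⟨⟨G', es', H, K₁, K₂, hop', hH, hK₁, hK₂, hK⟩, hlen⟩
    obtain ⟨rfl, rfl⟩ := HRRhs.op.inj (hop.symm.trans hop')
    have copy_H (i) : (D i).IsCopy (H i) := by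
      obtain ⟨_, H', iso, hsrcH, -⟩ := hK₁
      refine (ht i (H i)).1 ⟨hH i, ?_⟩
      rw [← (iso i).length_src, hsrcH, hatt, List.length_map]
    have copy_K₂ : D'.IsCopy K₂ := by
      obtain ⟨K₁', K₂', -, iso, hsrcK, -, -, -, -, hKsrc⟩ := hK
      refine (ht' K₂).1 ⟨hK₂, ?_⟩
      rw [← iso.length_src, ← hsrcK, ← hKsrc, hlen, hsrc]
      rfl
    exact (isPar_iff (isCopy_glue_of_isSubst hglue h₀ h hG hk hatt copy_H hK₁) copy_K₂).2 hK
  · intro hK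
    choose H hH using fun i => (h i).exists_isCopy
    obtain ⟨K₁, hK₁⟩ := exists_isSubst hglue h₀ h hG hk hatt hH
    obtain ⟨K₂, hK₂⟩ := h'.exists_isCopy
    exact ⟨⟨G, es, H, K₁, K₂, hop, fun i => ((ht i _).2 (hH i)).1, hK₁, ((ht' _).2 hK₂).1,
      (isPar_iff (isCopy_glue_of_isSubst hglue h₀ h hG hk hatt hH hK₁) hK₂).1 hK⟩, hK.length_src⟩

end Represents

end PreGraph

namespace SID

variable {L : Type u} {ar : L → ℕ} {P : Type v} {arP : P → ℕ}

/-- The vertex of the graph of a rule that represents a variable, in terms of its instance. -/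
noncomputable def instName (ρ : SIDRule ar arP) (args : List TVar) (p : List ℕ) : TVar → ℕ :=
  Function.extend (inst (n := arP ρ.head) (m := ρ.m) args p) ruleVarName fun _ => 0

section Rule

variable {ρ : SIDRule ar arP} {args : List TVar} {p : List ℕ}

theorem instName_comp_inst (h : FreshArgs args p (arP ρ.head)) :
    instName ρ args p ∘ inst (n := arP ρ.head) (m := ρ.m) args p = ruleVarName :=
  Function.extend_comp h.inst_injective _ _

theorem realizes_terminalPart_ruleGraph (h : FreshArgs args p (arP ρ.head)) (d : ℕ) :
    (bodyGraph ρ args p).Realizes (instName ρ args p) (fun x => Nat.pair d (2 * x.2))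
      (HRRhs.terminalPart (ρ.ruleGraph d)) where
  s_inj := Function.Injective.injOn_range
    ((instName_comp_inst h).symm ▸ ruleVarName_injective)
  g_inj := Set.InjOn.mono (bodyGraph_addrs_subset ρ args p)
    (Function.Injective.injOn_range (SIDRule.pair_two_mul_injective d))
  verts := by
    rw [bodyGraph, ← Set.range_comp, instName_comp_inst h]
    rfl
  edges := by
    rw [bodyGraph, QFormula.image_real_relEdges, instName_comp_inst h]
    exact SIDRule.termEdges_ruleGraph ρ d
  src := by
    have hargs : args = List.ofFn (inst (n := arP ρ.head) (m := ρ.m) args p ∘ Sum.inl) :=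
      (ofFn_inst_inl h.length).symm
    change List.ofFn (ruleVarName ∘ Sum.inl) = args.map (instName ρ args p)
    rw [congrArg (List.map _) hargs, List.map_ofFn, ← Function.comp_assoc, instName_comp_inst h]

theorem att_getElem_callList (h : FreshArgs args p (arP ρ.head)) (d : ℕ) {i : ℕ}
    (hi : i < (ρ.callList d).length) :
    (ρ.callList d)[i].att = (callArgs ρ args p i).map (instName ρ args p) := by
  have hi' : i < ρ.calls.length := ρ.length_callList d ▸ hi
  rw [SIDRule.getElem_callList hi', callArgs_eq_ofFn (List.getElem?_eq_getElem hi'), List.map_ofFn,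
    ← instName_comp_inst h]
  rfl

end Rule

theorem represents_charGraph {Δ : SID ar arP} {Γ : HRGrammar ar arP}
    {γ : Δ.rules → Γ.rules} {idx : Δ.rules → ℕ} (hγ : ∀ ρ, (γ ρ).1 = ρ.1.toHR (idx ρ))
    (heq : Δ.EqualityFree) {T : PTree Δ.rules} {n : ℕ} (hT : WellTyped T n) {args : List TVar}
    {p : List ℕ} (h : FreshArgs args p n) : (charGraph T args p).Represents (T.map γ) := by
  induction T generalizing n args p with
  | leaf => exact PreGraph.represents_leaf h.nodup
  | edge ρ k sub rest ihs ihr =>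
    obtain ⟨hprod, rfl, rfl, -, hrest⟩ := id hT
    choose c hc hsub using hT.exists_call
    have hfresh i := h.callArgs (heq ρ.1 ρ.2) (hc i)
    have hop : (γ ρ).1.2 = .op (ρ.1.ruleGraph (idx ρ)) (ρ.1.callList (idx ρ)) := by
      rw [hγ, SIDRule.toHR_of_not_unproductive hprod]
    refine PreGraph.represents_edge hop (gluable_bodyGraph hT h) (gluable_edgeGraph hT h)
      (charGraph_src rest args _) (wf_bodyGraph h) (fun i => wf_charGraph heq (hsub i) (hfresh i))
      (wf_charGraph heq hrest (h.cons 0)) (realizes_terminalPart_ruleGraph h (idx ρ))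
      (ρ.1.length_callList _) (fun i => ?_) (fun i => ihs i (hsub i) (hfresh i))
      (ihr hrest (h.cons 0))
    rw [charGraph_src]
    exact att_getElem_callList h (idx ρ) _

end SID

/-! ## Canonical models -/

namespace CGraph

variable {L : Type u} {ar : L → ℕ} {K : CGraph ar} {R : ℕ → ℕ → Prop} {M : ℕ}

theorem exists_forall_id_le (K : CGraph ar) : ∃ M, ∀ e ∈ K.edges, e.id ≤ M :=
  let ⟨M, hM⟩ := (K.edges_finite.image HEdge.id).bddAbove
  ⟨M, fun e he => hM ⟨e, he, rfl⟩⟩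

/-- The graph `K` together with an edge with the label `none` for every pair of vertices related by
`R`. The identities of the new edges exceed the bound `M` on the old ones. -/
def enrich (K : CGraph ar) (R : ℕ → ℕ → Prop) (hM : ∀ e ∈ K.edges, e.id ≤ M) :
    CGraph (arD ar) where
  verts := K.verts
  edges := (fun e => ⟨e.id, some e.lab, e.att⟩) '' K.edges ∪
    (fun x => ⟨M + 1 + Nat.pair x.1 x.2, none, [x.1, x.2]⟩) ''
      {x : ℕ × ℕ | x ∈ K.verts ×ˢ K.verts ∧ R x.1 x.2}
  src := K.src
  verts_finite := K.verts_finite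
  edges_finite := (K.edges_finite.image _).union
    (((K.verts_finite.prod K.verts_finite).subset fun _ hx => hx.1).image _)
  id_inj := by
    rintro _ (⟨e, he, rfl⟩ | ⟨x, -, rfl⟩) _ (⟨e', he', rfl⟩ | ⟨x', -, rfl⟩) hid <;>
      dsimp only at hid
    · rw [K.id_inj e he e' he' hid]
    · have := hM e he
      omega
    · have := hM e' he'
      omega
    · have hx := Nat.pair_eq_pair.1 (Nat.add_left_cancel hid)
      rw [Prod.ext hx.1 hx.2]
  att_length := by
    rintro _ (⟨e, he, rfl⟩ | ⟨x, -, rfl⟩)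
    · exact K.att_length e he
    · rfl
  att_mem := by
    rintro _ (⟨e, he, rfl⟩ | ⟨x, ⟨hx, -⟩, rfl⟩)
    · exact K.att_mem e he
    · exact List.forall_mem_cons.2 ⟨hx.1, List.forall_mem_singleton.2 hx.2⟩
  src_mem := K.src_mem
  src_nodup := K.src_nodup

theorem proj_enrich (hM : ∀ e ∈ K.edges, e.id ≤ M) : (K.enrich R hM).proj = K := by
  refine CGraph.ext rfl (Set.ext fun e => ⟨?_, fun he => Or.inl ⟨e, he, rfl⟩⟩) rfl
  rintro (⟨⟨i, r, xs⟩, he, h⟩ | ⟨x, -, h⟩)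
  · obtain ⟨rfl, hlab, rfl⟩ := HEdge.mk.inj h
    obtain rfl : r = e.lab := Option.some_injective _ hlab
    exact he
  · nomatch congrArg HEdge.lab h

theorem exists_none_mem_edges_enrich (hM : ∀ e ∈ K.edges, e.id ≤ M) {a b : ℕ} (ha : a ∈ K.verts)
    (hb : b ∈ K.verts) :
    (∃ e ∈ (K.enrich R hM).edges, e.lab = none ∧ e.att = [a, b]) ↔ R a b := by
  constructor
  · rintro ⟨_, ⟨e, -, rfl⟩ | ⟨x, ⟨-, hx⟩, rfl⟩, hlab, hatt⟩
    · simp at hlab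
    · simp only [List.cons.injEq, and_true] at hatt
      exact hatt.1 ▸ hatt.2 ▸ hx
  · exact fun h => ⟨_, Or.inr ⟨(a, b), ⟨⟨ha, hb⟩, h⟩, rfl⟩, rfl, rfl⟩

end CGraph

theorem PreGraph.Realizes.simple {L : Type u} {ar : L → ℕ} {X : Type v} {D : PreGraph L X}
    {s g s₀ g₀ : X → ℕ} {K K₀ : CGraph ar} (hK : D.Realizes s g K) (hD : D.WF ar)
    (hg₀ : Set.InjOn g₀ D.addrs) (hK₀ : K₀.edges = PreEdge.real s₀ g₀ '' D.edges)
    (hsimple : K₀.Simple) : K.Simple := by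
  obtain ⟨f, hf⟩ := exists_eqOn_comp_of_injOn hK.s_inj s₀
  have map_s₀ {e : PreEdge L X} (he : e ∈ D.edges) : e.att.map s₀ = (e.att.map s).map f := by
    rw [List.map_map]
    exact List.map_congr_left fun x hx => (hf (hD.att_mem e he x hx)).symm
  unfold CGraph.Simple at hsimple ⊢
  rw [hK₀] at hsimple
  rw [hK.edges]
  rintro _ ⟨e, he, rfl⟩ _ ⟨e', he', rfl⟩ hlab hatt
  have hatt₀ : e.att.map s₀ = e'.att.map s₀ := by
    rw [map_s₀ he, map_s₀ he']
    exact congrArg (List.map f) hatt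
  have hid := congrArg HEdge.id (hsimple _ ⟨e, he, rfl⟩ _ ⟨e', he', rfl⟩ hlab hatt₀)
  rw [hD.addr_inj he he' (hg₀ (addr_mem_addrs he) (addr_mem_addrs he') hid)]

namespace QFormula

variable {L : Type u} {ar : L → ℕ} {X : Type v} {φ : QFormula ar X} {D : PreGraph L X}

/-- The formula `φ` has no equalities, all of its variables occur in relation atoms, and `D` is the
hypergraph of these variables and relation atoms. -/
structure IsPresentedBy (φ : QFormula ar X) (D : PreGraph L X) : Prop where
  wf : D.WF ar
  src_eq_nil : D.src = []
  describes : φ.Describes D.edges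
  verts_eq : D.verts = PreEdge.attVerts D.edges
  eq_notMem : ∀ x y, Atom.eq x y ∉ φ.atoms
  vars_subset : ∀ a ∈ φ.atoms, a.vars ⊆ D.verts

theorem IsPresentedBy.fv_eq (h : φ.IsPresentedBy D) : φ.fv = D.verts := by
  refine Set.Subset.antisymm (fun x ⟨a, ha, hx⟩ => h.vars_subset a ha hx) ?_
  rw [h.verts_eq]
  rintro x ⟨e, he, hx⟩
  obtain ⟨xs, hatt, hmem⟩ := h.describes.exists_rel_mem e he
  rw [hatt, List.mem_ofFn] at hx
  exact ⟨_, hmem, hx⟩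

theorem IsPresentedBy.models_of_realizes (h : φ.IsPresentedBy D) (hsat : φ.Satisfiable)
    {s g : X → ℕ} {K : CGraph ar} (hK : D.Realizes s g K) : Models K s φ := by
  obtain ⟨K₀, s₀, -, hsimple, hK₀⟩ := hsat
  obtain ⟨hpure, g₀, hg₀, -, hedges⟩ := (h.describes.sat_iff s₀ K₀).1 hK₀
  refine ⟨?_, hK.simple h.wf hg₀ hedges hsimple,
    (h.describes.sat_iff s K).2 ⟨fun a ha => ?_, g, hK.g_inj, ?_, hK.edges⟩⟩
  · rw [hK.src, h.src_eq_nil, List.map_nil]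
  · have hvars := h.vars_subset a ha
    have ha₀ := hpure a ha
    cases a with
    | eq x y => exact absurd ha (h.eq_notMem x y)
    | neq x y =>
      exact fun hxy => ha₀ (congrArg s₀ (hK.s_inj (hvars (Or.inl rfl)) (hvars (Or.inr rfl)) hxy))
    | rel r xs => trivial
  · rw [← h.verts_eq, hK.verts]

theorem IsPresentedBy.canonical_iff_injOn [Encodable X] (h : φ.IsPresentedBy D)
    (hsat : φ.Satisfiable) (s : X → ℕ) : Canonical s φ ↔ Set.InjOn s D.verts := by
  rw [← h.fv_eq]
  constructor
  · intro hs x hx y hy hxy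
    obtain ⟨K, hK⟩ := h.wf.exists_realizes (s := Encodable.encode) (g := Encodable.encode)
      Encodable.encode_injective.injOn Encodable.encode_injective.injOn
    exact Encodable.encode_injective (hs x hx y hy hxy K _ (h.models_of_realizes hsat hK))
  · intro hs x hx y hy hxy
    obtain rfl := hs hx hy hxy
    exact fun _ _ _ => rfl

theorem IsPresentedBy.canonical_and_models_iff [Encodable X] (h : φ.IsPresentedBy D)
    (hsat : φ.Satisfiable) {s : X → ℕ} {K : CGraph ar} :
    Canonical s φ ∧ Models K s φ ↔ ∃ g, D.Realizes s g K := by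
  rw [h.canonical_iff_injOn hsat]
  constructor
  · rintro ⟨hs, hsrc, -, hmod⟩
    obtain ⟨-, g, hg, hverts, hedges⟩ := (h.describes.sat_iff s K).1 hmod
    exact ⟨g, hs, hg, h.verts_eq ▸ hverts, hedges, by rw [hsrc, h.src_eq_nil, List.map_nil]⟩
  · rintro ⟨g, hK⟩
    exact ⟨hK.s_inj, h.models_of_realizes hsat hK⟩

end QFormula

namespace SID

variable {L : Type u} {ar : L → ℕ} {P : Type v} {arP : P → ℕ} {Δ : SID ar arP} {A : P}

theorem freshArgs_nil : FreshArgs [] [] 0 := ⟨rfl, List.nodup_nil, fun _ hx => absurd hx (by simp)⟩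

theorem isPresentedBy_charGraph (hreg : Δ.Regular) (heq : Δ.EqualityFree) {T : PTree Δ.rules}
    (hT : WellTyped T 0) (hleaf : T ≠ .leaf) :
    (charForm T).IsPresentedBy (charGraph T [] []) where
  wf := wf_charGraph heq hT freshArgs_nil
  src_eq_nil := charGraph_src T [] []
  describes := describes_charFormAux T [] []
  verts_eq := (charGraph_verts_subset_attVerts hreg.regularBody hleaf hT rfl).antisymm
    fun x ⟨e, he, hx⟩ => (wf_charGraph heq hT freshArgs_nil).att_mem e he x hx
  eq_notMem := eq_notMem_atoms_charFormAux heq T [] []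
  vars_subset := fun _ ha => vars_subset_charGraph_verts ha

theorem mem_canonicalModels_iff (hA : arP A = 0) (hreg : Δ.Regular) (heq : Δ.EqualityFree)
    (hsat : Δ.AllSatisfiable A) {K : CGraph ar} :
    K ∈ Δ.canonicalModels A ↔ ∃ T ∈ Δ.parseTrees A, (charGraph T [] []).IsCopy K := by
  have models_iff {T} (hT : T ∈ Δ.parseTrees A) {s : TVar → ℕ} {K : CGraph ar} :
      QFormula.Canonical s (charForm T) ∧ QFormula.Models K s (charForm T) ↔
        ∃ g, (charGraph T [] []).Realizes s g K := by
    obtain ⟨hwt, hleaf⟩ := wellTyped_of_mem_parseTrees hreg.calls_ne_nil hT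
    exact (isPresentedBy_charGraph hreg heq (hA ▸ hwt) hleaf).canonical_and_models_iff (hsat T hT)
  constructor
  · rintro ⟨G, ⟨T, hT, s, hs, hmod, -⟩, rfl⟩
    exact ⟨T, hT, s, (models_iff hT).1 ⟨hs, hmod⟩⟩
  · rintro ⟨T, hT, s, hK⟩
    obtain ⟨hs, hmod⟩ := (models_iff hT).2 hK
    obtain ⟨M, hM⟩ := K.exists_forall_id_le
    refine ⟨K.enrich (fun a b => ∃ x y, s x = a ∧ s y = b ∧ Atom.neq x y ∈ (charForm T).atoms) hM,
      ⟨T, hT, s, hs, ?_, fun a ha b hb => CGraph.exists_none_mem_edges_enrich hM ha hb⟩,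
      CGraph.proj_enrich hM⟩
    rwa [CGraph.proj_enrich]

section Grammar

variable {idx : Δ.rules → ℕ}

/-- The bijection between the rules of a SID and those of its grammar. -/
noncomputable def rulesEquiv (hreg : Δ.Regular) (heq : Δ.EqualityFree) (A : P)
    (hidx : Function.Injective idx) : Δ.rules ≃ (Δ.toGrammar heq A idx).rules :=
  Equiv.ofInjective _ (toHR_injective hreg hidx)

theorem map_rulesEquiv_mem_parseTrees_iff (hreg : Δ.Regular) (heq : Δ.EqualityFree)
    (hidx : Function.Injective idx) (T : PTree Δ.rules) :
    T.map (rulesEquiv hreg heq A hidx) ∈ (Δ.toGrammar heq A idx).parseTrees A ↔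
      T ∈ Δ.parseTrees A := by
  have rhs_eq (ρ : Δ.rules) : (rulesEquiv hreg heq A hidx ρ).1.2.nonterms =
      ρ.1.calls.map PredAtom.pred := SIDRule.nonterms_toHR ρ.1 (idx ρ)
  have unprod_eq (ρ : Δ.rules) : (rulesEquiv hreg heq A hidx ρ).1.2.IsPar = ρ.1.Unproductive :=
    propext (SIDRule.isPar_toHR ρ.1 (idx ρ))
  rw [HRGrammar.parseTrees, map_mem_parseTrees_iff, parseTrees]
  simp only [Function.comp_def, rhs_eq, unprod_eq]
  rfl

theorem canonicalModels_eq_language (hreg : Δ.Regular) (heq : Δ.EqualityFree)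
    (hidx : Function.Injective idx) (hA : arP A = 0) (hsat : Δ.AllSatisfiable A) :
    Δ.canonicalModels A = (Δ.toGrammar heq A idx).language A := by
  let γ := rulesEquiv hreg heq A hidx
  have value_iff {T} (hT : T ∈ Δ.parseTrees A) (K : CGraph ar) :
      HRGrammar.IsVal (T.map γ) K ∧ K.src.length = arP A ↔ (charGraph T [] []).IsCopy K := by
    have hwt := (wellTyped_of_mem_parseTrees hreg.calls_ne_nil hT).1
    rw [hA] at hwt ⊢
    have := represents_charGraph (γ := γ) (fun _ => rfl) heq hwt freshArgs_nil K
    rwa [charGraph_src] at this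
  ext K
  rw [mem_canonicalModels_iff hA hreg heq hsat]
  constructor
  · rintro ⟨T, hT, hK⟩
    obtain ⟨hval, hlen⟩ := (value_iff hT K).2 hK
    exact ⟨hlen, T.map γ, (map_rulesEquiv_mem_parseTrees_iff hreg heq hidx T).2 hT, hval⟩
  · rintro ⟨hlen, T', hT', hval⟩
    obtain ⟨T, rfl⟩ : ∃ T, T.map γ = T' :=
      ⟨T'.map γ.symm, by rw [PTree.map_map, Equiv.self_comp_symm, PTree.map_id]⟩
    have hT := (map_rulesEquiv_mem_parseTrees_iff hreg heq hidx T).1 hT'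
    exact ⟨T, hT, (value_iff hT K).1 ⟨hval, hlen⟩⟩

end Grammar

end SID

theorem mainTheorem2 {L : Type u} (ar : L → ℕ) {P : Type v} (arP : P → ℕ)
    (Δ : SID ar arP) (A : P) (hA : arP A = 0)
    (hreg : Δ.Regular) (heq : Δ.EqualityFree) (hsat : Δ.AllSatisfiable A) :
    ∃ (N : Type v) (arN : N → ℕ) (Γ : HRGrammar ar arN) (w : N) (γ : Δ.rules ≃ Γ.rules),
      Γ.Regular ∧ w ∈ Γ.nonterms ∧ arN w = 0 ∧
      (∀ T : PTree Δ.rules, T ∈ Δ.parseTrees A ↔ T.map γ ∈ Γ.parseTrees w) ∧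
      Δ.canonicalModels A = Γ.language w := by
  have := Δ.finite.to_subtype
  obtain ⟨idx, hidx⟩ := Countable.exists_injective_nat Δ.rules
  exact ⟨P, arP, Δ.toGrammar heq A idx, A, SID.rulesEquiv hreg heq A hidx,
    SID.toGrammar_regular hreg heq A idx, Set.mem_insert _ _, hA,
    fun T => (SID.map_rulesEquiv_mem_parseTrees_iff hreg heq hidx T).symm,
    SID.canonicalModels_eq_language hreg heq hidx hA hsat⟩
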